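/- **Setting.** Let $\Gamma$ be a finite directed graph (multiple edges and loops allowed) in which every vertex has out-degree at least $1$, and in which the only outgoing edge of any vertex of out-degree $1$ is a loop. For each vertex $v$ fix a linear order $e_1<\dots<e_d$ of the edges originating from $v$; we write $\mathrm{ch}(v)=(\mathrm{term}(e_1),\dots,\mathrm{term}(e_d))$. **Strand diagrams.** A $\Gamma$-strand diagram with domain $(a_1,\dots,a_n)$ and range $(b_1,\dots,b_m)$ (tuples of vertices of $\Gamma$) is a finite acyclic directed graph whose vertices (points) and edges (strands) are colored by vertices of $\Gamma$, with $n$ linearly ordered univalent sources colored $a_1,\dots,a_n$ and $m$ linearly ordered univalent sinks colored $b_1,\dots,b_m$ (each of the same color as the strand at it), all of whose other points are of one of the following kinds: * a *split* of color $c$, where $c$ has out-degree $d\ge 2$: one incoming strand, of color $c$, and $d$ numbered outgoing strands, with colors $\mathrm{ch}(c)$ in this order; * a *merge* of color $c$, where $c$ has out-degree $d\ge2$: one outgoing strand, of color $c$, and $d$ numbered incoming strands, with colors $\mathrm{ch}(c)$ in this order; * a *degenerate* point of color $c$, where the only edge originating from $c$ is a loop: one incoming and one outgoing strand, both of color $c$.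 (A source that is itself a split is regarded as a univalent source immediately followed by a split, and dually for sinks.) Diagrams are considered up to isomorphism. **Reductions of types 0, 1, 2.** Type 0: remove a degenerate point and attach the two strands at it into one. Type 1: if for every $i$ the $i$-th strand leaving a split of color $c$ is the $i$-th strand entering a merge of color $c$, remove both points and these strands and attach the strand entering the split with the one leaving the merge. Type 2: if the strand leaving a merge of color $c$ enters a split of color $c$, remove both points and this strand and, for every $i$, attach the $i$-th strand entering the merge with the $i$-th strand leaving the split. Let $[F]$ be the class of $F$ for the equivalence relation generated by these reductions. **The groupoid.** The objects of $\mathcal G(\Gamma)$ are the finite tuples of vertices of $\Gamma$, and its elements are the classes $[F]$. If the range of $A$ is the domain of $B$, then $[A][B]=[AB]$, where $AB$ is obtained by gluing each sink of $A$ with the corresponding source of $B$ (so that the two strands there become one). Two elements $f,g$, each with equal domain and range, are conjugate if $f=hgh^{-1}$ for some invertible element $h$ of $\mathcal G(\Gamma)$. **Closed diagrams.** If the domain and range of $F$ are equal, the closed diagram $\mathcal C(F)$ is obtained by identifying, for every $i$, the $i$-th source with the $i$-th sink, which become the $i$-th base point. The ordered sequence of base points is the base line. Closed diagrams are transformed as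 follows. * *Base line shifts.* Let $X$ be a diagram that consists of a single split, or a single merge, surrounded by straight strands (strands joining a source to a sink without crossing). For every diagram $R$ such that $XR$ and $RX$ are defined, $\mathcal C(XR)$ may be replaced by $\mathcal C(RX)$ and vice versa; that is, a split or merge adjacent to the base line is moved through it. * *Base line permutations.* The base points are put in a different order. * *Reductions of types 0, 1, 2.* $\mathcal C(F)$ is replaced by $\mathcal C(F^*)$, where $F^*$ is obtained from $F$ by such a reduction. * *Reductions of type 3.* Let $v$ be a vertex with outgoing edges $e_1<\dots<e_d$, let $k\ge1$, and suppose that $y_{i+1},\dots,y_{i+kd}$ are consecutive base points such that, for every $j\in\{1,\dots,d\}$, there is a directed cycle (loop) with points exactly $y_{i+j},y_{i+j+d},\dots,y_{i+j+(k-1)d}$, in this order, of color $\mathrm{term}(e_j)$. These $d$ loops are replaced by a single loop of color $v$ with $k$ consecutive new base points $y'_{i+1},\dots,y'_{i+k}$, in this order. Base line shifts and permutations are called similarities. Two closed diagrams are *equivalent* if one can be obtained from the other by finitely many similarities, reductions of types 0–3 and inverses of reductions. **Proposition.** Let $F$ and $G$ be $\Gamma$-strand diagrams, each with equal domain and range.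 Then $[F]$ and $[G]$ are conjugate in $\mathcal G(\Gamma)$ if and only if $\mathcal C(F)$ and $\mathcal C(G)$ are equivalent. -/

import Mathlib

universe u w

namespace EdgeShift

/-- A directed graph (multiple edges and loops allowed) with vertex set `V` and edge set `E`, in
which every vertex `v` has finitely many outgoing edges and these are linearly ordered:
`edge v 0 < edge v 1 < ⋯` is the increasing list of all edges originating from `v`. -/
structure OrderedGraph (V : Type u) (E : Type w) where
  init : E → V
  term : E → V
  outDegree : V → ℕ
  edge : ∀ v, Fin (outDegree v) ≃ {e : E // init e = v}

/-- A finite tuple of elements of `V`; equivalently a finite multiset over `V` with a linear order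
of its elements. -/
structure Tuple (V : Type u) where
  len : ℕ
  col : Fin len → V

namespace Tuple

variable {V : Type u}

/-- The tuple `(v)`. -/
def single (v : V) : Tuple V := ⟨1, fun _ => v⟩

/-- Concatenation of tuples. -/
def append (a b : Tuple V) : Tuple V := ⟨a.len + b.len, Fin.append a.col b.col⟩

/-- The concatenation of `k` copies of the tuple `a`. -/
def copies (k : ℕ) (a : Tuple V) : Tuple V :=
  ⟨k * a.len, fun p => a.col (finProdFinEquiv.symm p).2⟩

end Tuple

/-- The type of a point of a strand diagram that is neither a source nor a sink, with its color. -/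
inductive PointType (V : Type u) where
  | split (c : V)
  | merge (c : V)
  | degenerate (c : V)

namespace OrderedGraph

variable {V : Type u} {E : Type w} (Γ : OrderedGraph V E)

/-- The tuple `(term e₁, …, term e_k)`, where `e₁ < ⋯ < e_k` are the edges originating from `v`. -/
def children (v : V) : Tuple V := ⟨Γ.outDegree v, fun i => Γ.term (Γ.edge v i)⟩

/-- The number of strands originating from a point. -/
def numOut : PointType V → ℕ
  | .split c => Γ.outDegree c
  | .merge _ => 1
  | .degenerate _ => 1

/-- The number of strands terminating at a point. -/
def numIn : PointType V → ℕ
  | .split _ => 1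
  | .merge c => Γ.outDegree c
  | .degenerate _ => 1

/-- The color of the `i`-th strand originating from a point. -/
def outColor : (t : PointType V) → Fin (Γ.numOut t) → V
  | .split c, i => (Γ.children c).col i
  | .merge c, _ => c
  | .degenerate c, _ => c

/-- The color of the `i`-th strand terminating at a point. -/
def inColor : (t : PointType V) → Fin (Γ.numIn t) → V
  | .split c, _ => c
  | .merge c, i => (Γ.children c).col i
  | .degenerate c, _ => c

/-- Splits and merges involve at least two strands on their branching side; the color of a
degenerate point is a vertex whose only outgoing edge is a loop. -/
def Allowed : PointType V → Prop
  | .split c => 2 ≤ Γ.outDegree c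
  | .merge c => 2 ≤ Γ.outDegree c
  | .degenerate c => Γ.outDegree c = 1 ∧ ∀ e, Γ.init e = c → Γ.term e = c

end OrderedGraph

/-- A pair consisting of a point `pt` and one of the numbers `0, …, d pt - 1`: the ends of strands
at the points, when `d pt` strands originate from (or terminate at) `pt`. -/
@[ext]
structure Port {P : Type} (d : P → ℕ) where
  pt : P
  idx : ℕ
  lt : idx < d pt

namespace Port

variable {P Q : Type}

/-- Transport of ports along a map of points. -/
def map {d : P → ℕ} {d' : Q → ℕ} (f : P → Q) (h : ∀ p, d p = d' (f p)) (x : Port d) : Port d' :=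
  ⟨f x.pt, x.idx, h x.pt ▸ x.lt⟩

/-- Ports at a disjoint union of two sets of points. -/
def sumEquiv (d : P ⊕ Q → ℕ) :
    Port d ≃ Port (fun p => d (Sum.inl p)) ⊕ Port (fun q => d (Sum.inr q)) where
  toFun
    | ⟨.inl p, i, h⟩ => .inl ⟨p, i, h⟩
    | ⟨.inr q, i, h⟩ => .inr ⟨q, i, h⟩
  invFun
    | .inl ⟨p, i, h⟩ => ⟨.inl p, i, h⟩
    | .inr ⟨q, i, h⟩ => ⟨.inr q, i, h⟩
  left_inv := by rintro ⟨_ | _, _, _⟩ <;> rfl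
  right_inv := by rintro (⟨_, _, _⟩ | ⟨_, _, _⟩) <;> rfl

end Port

section Strands

variable {V : Type u} {E : Type w} (Γ : OrderedGraph V E) {P : Type}

/-- The places where strands originate: the sources (with colors `a`) and the outgoing ports of the
other points. -/
abbrev Origin (a : Tuple V) (type : P → PointType V) : Type :=
  Fin a.len ⊕ Port fun p => Γ.numOut (type p)

/-- The places where strands terminate: the sinks (with colors `b`) and the incoming ports of the
other points. -/
abbrev Terminus (b : Tuple V) (type : P → PointType V) : Type :=
  Fin b.len ⊕ Port fun p => Γ.numIn (type p)

/-- The color of a strand, read off at its origin. -/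
def originColor {a : Tuple V} {type : P → PointType V} : Origin Γ a type → V :=
  Sum.elim a.col fun x => Γ.outColor (type x.pt) ⟨x.idx, x.lt⟩

/-- The color of a strand, read off at its terminus. -/
def terminusColor {b : Tuple V} {type : P → PointType V} : Terminus Γ b type → V :=
  Sum.elim b.col fun x => Γ.inColor (type x.pt) ⟨x.idx, x.lt⟩

/-- There is a strand from the point `p` to the point `q`. -/
def Joined {a b : Tuple V} {type : P → PointType V}
    (strand : Origin Γ a type → Terminus Γ b type) (p q : P) : Prop :=
  ∃ x y, x.pt = p ∧ y.pt = q ∧ strand (Sum.inr x) = Sum.inr y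

end Strands

/-- A `Γ`-strand diagram with domain `a` and range `b`.

Sources and sinks are univalent; they are numbered in their linear order and colored by `a` and
`b`. (A source that is at the same time a split is drawn as a source followed by a split, and dually
for sinks, so that composing and closing diagrams needs no case distinctions.) `Pt` is the finite
set of all other points, and `type` records whether a point is a split, a merge or degenerate,
together with its color.

A strand is identified with its origin, and `strand` sends it to its terminus. The rotation system
is encoded by the numbering of the strands at a point: if `e₁ < ⋯ < e_k` are the edges of `Γ`
originating from the color of a split (merge), then the `i`-th strand originating from
(terminating at) the point corresponds to `e_i`, and the numbering is the cyclic order at the point,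
started right after the unique incoming strand (ended right before the unique outgoing strand,
read in the opposite direction). -/
structure StrandDiagram {V : Type u} {E : Type w} (Γ : OrderedGraph V E) (a b : Tuple V) where
  Pt : Type
  finite : Finite Pt
  type : Pt → PointType V
  allowed : ∀ p, Γ.Allowed (type p)
  strand : Origin Γ a type ≃ Terminus Γ b type
  color : ∀ x, terminusColor Γ (strand x) = originColor Γ x
  acyclic : ∀ p, ¬ Relation.TransGen (Joined Γ strand) p p

namespace StrandDiagram

variable {V : Type u} {E : Type w} {Γ : OrderedGraph V E} {a b c a' b' : Tuple V}

/-! ### Reductions -/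

section Maps

variable {P Q : Type} {type : P → PointType V} {type' : Q → PointType V}

/-- The map induced on origins of strands by a map of points. -/
def mapOrigin (f : P → Q) (h : ∀ p, type' (f p) = type p) :
    Origin Γ a type → Origin Γ a type' :=
  Sum.map _root_.id (Port.map f fun p => by rw [h])

/-- The map induced on termini of strands by a map of points. -/
def mapTerminus (f : P → Q) (h : ∀ p, type' (f p) = type p) :
    Terminus Γ b type → Terminus Γ b type' :=
  Sum.map _root_.id (Port.map f fun p => by rw [h])

end Maps

/-- Isomorphism of strand diagrams: a bijection of the points that respects everything else. -/
def Iso (F F' : StrandDiagram Γ a b) : Prop :=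
  ∃ (f : F'.Pt → F.Pt) (h : ∀ p, F.type (f p) = F'.type p), Function.Bijective f ∧
    ∀ x : Origin Γ a F'.type, mapTerminus f h (F'.strand x) = F.strand (mapOrigin f h x)

/-- `F'` is obtained from `F` by removing the points `v` and `w` and the strands between them, and
attaching the `i`-th strand terminating at `v` with the `i`-th strand originating from `w` into a
single strand, for every `i`. -/
def Bypass (F F' : StrandDiagram Γ a b) (v w : F.Pt) : Prop :=
  ∃ (f : F'.Pt → F.Pt) (h : ∀ p, F.type (f p) = F'.type p),
    Function.Injective f ∧ Set.range f = {v, w}ᶜ ∧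
    ∀ x : Origin Γ a F'.type,
      mapTerminus f h (F'.strand x) = F.strand (mapOrigin f h x) ∨
      ∃ (y : Port fun p => Γ.numIn (F.type p)) (z : Port fun p => Γ.numOut (F.type p)),
        y.pt = v ∧ z.pt = w ∧ y.idx = z.idx ∧
        F.strand (mapOrigin f h x) = Sum.inr y ∧
        mapTerminus f h (F'.strand x) = F.strand (Sum.inr z)

/-- Type 0: a degenerate point is removed. -/
def Reduction0 (F F' : StrandDiagram Γ a b) : Prop :=
  ∃ (v : F.Pt) (k : V), F.type v = .degenerate k ∧ F.Bypass F' v v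

/-- Type 1: a split `v` and a merge `w` of the same color, such that the `i`-th strand originating
from `v` is the `i`-th strand terminating at `w` for every `i`, are removed. -/
def Reduction1 (F F' : StrandDiagram Γ a b) : Prop :=
  ∃ (v w : F.Pt) (k : V), F.type v = .split k ∧ F.type w = .merge k ∧
    (∀ x : Port fun p => Γ.numOut (F.type p), x.pt = v →
      ∃ y : Port fun p => Γ.numIn (F.type p),
        y.pt = w ∧ y.idx = x.idx ∧ F.strand (Sum.inr x) = Sum.inr y) ∧
    F.Bypass F' v w

/-- Type 2: a merge `v` and a split `w` of the same color, such that the strand originating from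
`v` terminates at `w`, are removed. -/
def Reduction2 (F F' : StrandDiagram Γ a b) : Prop :=
  ∃ (v w : F.Pt) (k : V), F.type v = .merge k ∧ F.type w = .split k ∧
    Joined Γ F.strand v w ∧ F.Bypass F' v w

/-- `F'` is isomorphic to `F`, or is obtained from `F` by a reduction of type 0, 1 or 2. -/
def Step (F F' : StrandDiagram Γ a b) : Prop :=
  F.Iso F' ∨ F.Reduction0 F' ∨ F.Reduction1 F' ∨ F.Reduction2 F'

/-! ### Composition, juxtaposition, flips and permutations -/

/-- Origins of strands at a disjoint union of two sets of points. -/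
def originSum {P Q : Type} (s : P → PointType V) (t : Q → PointType V) :
    Origin Γ a (Sum.elim s t) ≃ Origin Γ a s ⊕ Port (fun q => Γ.numOut (t q)) :=
  (Equiv.sumCongr (Equiv.refl _) (Port.sumEquiv _)).trans (Equiv.sumAssoc _ _ _).symm

/-- Termini of strands at a disjoint union of two sets of points. -/
def terminusSum {P Q : Type} (s : P → PointType V) (t : Q → PointType V) :
    Terminus Γ b (Sum.elim s t) ≃ Terminus Γ b t ⊕ Port (fun p => Γ.numIn (s p)) :=
  (Equiv.sumCongr (Equiv.refl _) ((Port.sumEquiv _).trans (Equiv.sumComm _ _))).trans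
    (Equiv.sumAssoc _ _ _).symm

/-- The strands of the composition of `F` and `G`: a strand of `F` that terminates at the `i`-th
sink of `F` is attached with the strand of `G` that originates from the `i`-th source of `G`. -/
def compStrand (F : StrandDiagram Γ a b) (G : StrandDiagram Γ b c) :
    Origin Γ a (Sum.elim F.type G.type) ≃ Terminus Γ c (Sum.elim F.type G.type) :=
  (originSum F.type G.type).trans <|
  (Equiv.sumCongr F.strand (Equiv.refl _)).trans <|
  (Equiv.sumAssoc _ _ _).trans <|
  (Equiv.sumCongr (Equiv.refl _) (Equiv.sumComm _ _)).trans <|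
  (Equiv.sumAssoc _ _ _).symm.trans <|
  (Equiv.sumCongr G.strand (Equiv.refl _)).trans
  (terminusSum F.type G.type).symm

/-- Origins in `F`, regarded as origins in the composition. -/
def inclO (F : StrandDiagram Γ a b) (G : StrandDiagram Γ b c) :
    Origin Γ a F.type → Origin Γ a (Sum.elim F.type G.type) :=
  Sum.map id (Port.map Sum.inl fun _ => rfl)

/-- Termini in `G`, regarded as termini in the composition. -/
def inclT (F : StrandDiagram Γ a b) (G : StrandDiagram Γ b c) :
    Terminus Γ c G.type → Terminus Γ c (Sum.elim F.type G.type) :=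
  Sum.map id (Port.map Sum.inr fun _ => rfl)

/-- The terminus in the composition of a strand of `F` with the given terminus in `F`. -/
def contT (F : StrandDiagram Γ a b) (G : StrandDiagram Γ b c) :
    Terminus Γ b F.type → Terminus Γ c (Sum.elim F.type G.type) :=
  Sum.elim (fun j => inclT F G (G.strand (.inl j)))
    fun y => .inr (y.map Sum.inl fun _ => rfl)

section compStrand

variable (F : StrandDiagram Γ a b) (G : StrandDiagram Γ b c)

theorem compStrand_left (x : Origin Γ a F.type) :
    compStrand F G (inclO F G x) = contT F G (F.strand x) := by
  have : compStrand F G (inclO F G x) = (terminusSum F.type G.type).symm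
    (Equiv.sumCongr G.strand (Equiv.refl _) ((Equiv.sumAssoc _ _ _).symm
      (Equiv.sumCongr (Equiv.refl _) (Equiv.sumComm _ _)
        ((Equiv.sumAssoc _ _ _) (Sum.inl (F.strand x)))))) := by
    rcases x with i | ⟨p, i, h⟩ <;> rfl
  rw [this]
  rcases F.strand x with j | y
  · change (terminusSum F.type G.type).symm (Sum.inl (G.strand (Sum.inl j))) =
      inclT F G (G.strand (.inl j))
    rcases G.strand (Sum.inl j) with k | y <;> rfl
  · rfl

theorem compStrand_right (x : Port fun q => Γ.numOut (G.type q)) :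
    compStrand F G (.inr (x.map Sum.inr fun _ => rfl)) = inclT F G (G.strand (.inr x)) := by
  change (terminusSum F.type G.type).symm (Sum.inl (G.strand (Sum.inr x))) = _
  rcases G.strand (Sum.inr x) with k | y <;> rfl

theorem origin_cases {motive : Origin Γ a (Sum.elim F.type G.type) → Prop}
    (left : ∀ x, motive (inclO F G x))
    (right : ∀ x : Port fun q => Γ.numOut (G.type q),
      motive (.inr (x.map Sum.inr fun _ => rfl))) (x) : motive x := by
  rcases x with i | ⟨p | q, i, h⟩
  · exact left (.inl i)
  · exact left (.inr ⟨p, i, h⟩)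
  · exact right ⟨q, i, h⟩

end compStrand

/-- The composition `F G` of diagrams (`F` comes first, on top of `G`): every sink of `F` is glued
with the corresponding source of `G`. -/
@[reducible]
def comp (F : StrandDiagram Γ a b) (G : StrandDiagram Γ b c) : StrandDiagram Γ a c where
  Pt := F.Pt ⊕ G.Pt
  finite := by have := F.finite; have := G.finite; infer_instance
  type := Sum.elim F.type G.type
  allowed := by rintro (p | q); exacts [F.allowed p, G.allowed q]
  strand := compStrand F G
  color x := by
    have hT : ∀ y, terminusColor Γ (inclT F G y) = terminusColor Γ y := by
      rintro (_ | _) <;> rfl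
    induction x using origin_cases with
    | left x =>
      rw [compStrand_left]
      have h : originColor Γ (inclO F G x) = originColor Γ x := by rcases x with _ | _ <;> rfl
      rw [h, ← F.color x]
      rcases F.strand x with j | y
      · exact (hT _).trans (G.color (.inl j))
      · rfl
    | right x =>
      rw [compStrand_right]
      exact (hT _).trans (G.color (.inr x))
  acyclic := by
    have key : ∀ x y, Joined Γ (compStrand F G) x y →
        (∀ q, x = Sum.inr q → ∃ q', y = Sum.inr q' ∧ Joined Γ G.strand q q') ∧
        (∀ p', y = Sum.inl p' → ∃ p, x = Sum.inl p ∧ Joined Γ F.strand p p') := by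
      rintro _ _ ⟨x, y, rfl, rfl, hxy⟩
      obtain ⟨p | q, i, h⟩ := x
      · have e := compStrand_left F G (.inr ⟨p, i, h⟩)
        refine ⟨fun q hq => by simp at hq, fun p' hp' => ⟨p, rfl, ?_⟩⟩
        have e' := e.symm.trans hxy
        rcases hF : F.strand (.inr ⟨p, i, h⟩) with j | z
        · rw [hF] at e'
          simp only [contT, Sum.elim_inl] at e'
          rcases hG : G.strand (.inl j) with k | z <;> rw [hG] at e'
          · simp [inclT] at e'
          · have := congrArg Port.pt (Sum.inr_injective e')
            rw [hp'] at this
            simp [Port.map] at this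
        · rw [hF] at e'
          have := congrArg Port.pt (Sum.inr_injective e')
          rw [hp'] at this
          exact ⟨_, z, rfl, Sum.inl_injective this, hF⟩
      · have e := compStrand_right F G ⟨q, i, h⟩
        have e' := e.symm.trans hxy
        rcases hG : G.strand (.inr ⟨q, i, h⟩) with k | z <;> rw [hG] at e'
        · simp [inclT] at e'
        · have := congrArg Port.pt (Sum.inr_injective e')
          refine ⟨fun q' hq => ⟨z.pt, this.symm, ?_⟩, fun p' hp' => ?_⟩
          · obtain rfl := Sum.inr_injective hq
            exact ⟨_, z, rfl, rfl, hG⟩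
          · rw [hp'] at this
            simp [Port.map] at this
    have right : ∀ x y, Relation.TransGen (Joined Γ (compStrand F G)) x y →
        ∀ q, x = Sum.inr q → ∃ q', y = Sum.inr q' ∧ Relation.TransGen (Joined Γ G.strand) q q' := by
      intro x y h q hq
      induction h with
      | single h =>
        obtain ⟨q', h1, h2⟩ := (key _ _ h).1 q hq
        exact ⟨q', h1, .single h2⟩
      | tail _ h ih =>
        obtain ⟨q', h1, h2⟩ := ih
        obtain ⟨q'', h3, h4⟩ := (key _ _ h).1 q' h1
        exact ⟨q'', h3, h2.tail h4⟩
    have left : ∀ x y, Relation.TransGen (Joined Γ (compStrand F G)) x y →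
        ∀ p', y = Sum.inl p' → ∃ p, x = Sum.inl p ∧ Relation.TransGen (Joined Γ F.strand) p p' := by
      intro x y h
      induction h with
      | single h =>
        intro p' hp'
        obtain ⟨p, h1, h2⟩ := (key _ _ h).2 p' hp'
        exact ⟨p, h1, .single h2⟩
      | tail _ h ih =>
        intro p' hp'
        obtain ⟨p, h1, h2⟩ := (key _ _ h).2 p' hp'
        obtain ⟨p'', h3, h4⟩ := ih p h1
        exact ⟨p'', h3, h4.tail h2⟩
    rintro (p | q) h
    · obtain ⟨p', h1, h2⟩ := left _ _ h p rfl
      obtain rfl := Sum.inl_injective h1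
      exact F.acyclic _ h2
    · obtain ⟨q', h1, h2⟩ := right _ _ h q rfl
      obtain rfl := Sum.inr_injective h1
      exact G.acyclic _ h2

/-- The diagram without splits, merges and degenerate points in which the `i`-th source is joined
to the `σ i`-th sink. -/
def ofEquiv (σ : Fin a.len ≃ Fin b.len) (h : ∀ i, b.col (σ i) = a.col i) :
    StrandDiagram Γ a b where
  Pt := Empty
  finite := inferInstance
  type := Empty.elim
  allowed p := p.elim
  strand := Equiv.sumCongr σ ⟨fun x => x.pt.elim, fun x => x.pt.elim, fun x => x.pt.elim,
    fun x => x.pt.elim⟩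
  color := by
    rintro (i | x)
    · exact h i
    · exact x.pt.elim
  acyclic p := p.elim

/-- The identity diagram, consisting of straight strands. -/
def id (a : Tuple V) : StrandDiagram Γ a a := ofEquiv (Equiv.refl _) fun _ => rfl

/-- The diagram with a single split of color `v`. -/
def caret (v : V) (hv : 2 ≤ Γ.outDegree v) :
    StrandDiagram Γ (Tuple.single v) (Γ.children v) where
  Pt := Unit
  finite := inferInstance
  type _ := .split v
  allowed _ := hv
  strand :=
    { toFun := Sum.elim (fun _ => .inr ⟨(), 0, Nat.zero_lt_one⟩) fun x => .inl ⟨x.idx, x.lt⟩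
      invFun := Sum.elim (fun i => .inr ⟨(), i.1, i.2⟩) fun _ => .inl (0 : Fin 1)
      left_inv := by
        rintro (i | x)
        · exact congrArg Sum.inl (Subsingleton.elim (α := Fin 1) _ _)
        · rfl
      right_inv := by
        rintro (i | ⟨_, i, h⟩)
        · rfl
        · obtain rfl : i = 0 := Nat.lt_one_iff.1 h
          rfl }
  color := by rintro (i | x) <;> rfl
  acyclic p hp := by
    obtain ⟨_, ⟨x, y, -, -, h⟩, -⟩ := Relation.TransGen.head'_iff.1 hp
    simp at h

/-- The diagram with a single merge of color `v`. -/
def invertedCaret (v : V) (hv : 2 ≤ Γ.outDegree v) :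
    StrandDiagram Γ (Γ.children v) (Tuple.single v) where
  Pt := Unit
  finite := inferInstance
  type _ := .merge v
  allowed _ := hv
  strand :=
    { toFun := Sum.elim (fun i => .inr ⟨(), i.1, i.2⟩) fun _ => .inl (0 : Fin 1)
      invFun := Sum.elim (fun _ => .inr ⟨(), 0, Nat.zero_lt_one⟩) fun x => .inl ⟨x.idx, x.lt⟩
      left_inv := by
        rintro (i | ⟨_, i, h⟩)
        · rfl
        · obtain rfl : i = 0 := Nat.lt_one_iff.1 h
          rfl
      right_inv := by
        rintro (i | x)
        · exact congrArg Sum.inl (Subsingleton.elim (α := Fin 1) _ _)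
        · rfl }
  color := by rintro (i | x) <;> rfl
  acyclic p hp := by
    obtain ⟨_, ⟨x, y, -, -, h⟩, -⟩ := Relation.TransGen.head'_iff.1 hp
    simp at h

/-- The strands of the juxtaposition of `F` and `G`. -/
def juxtaposeStrand (F : StrandDiagram Γ a b) (G : StrandDiagram Γ a' b') :
    Origin Γ (a.append a') (Sum.elim F.type G.type) ≃
      Terminus Γ (b.append b') (Sum.elim F.type G.type) :=
  (Equiv.sumCongr finSumFinEquiv.symm (Port.sumEquiv _)).trans <|
  (Equiv.sumSumSumComm _ _ _ _).trans <|
  (Equiv.sumCongr F.strand G.strand).trans <|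
  (Equiv.sumSumSumComm _ _ _ _).symm.trans
  (Equiv.sumCongr finSumFinEquiv (Port.sumEquiv fun p => Γ.numIn (Sum.elim F.type G.type p)).symm)

theorem juxtaposeStrand_left (F : StrandDiagram Γ a b) (G : StrandDiagram Γ a' b')
    (x : Origin Γ a F.type) :
    juxtaposeStrand F G (Sum.map (Fin.castAdd a'.len) (Port.map Sum.inl fun _ => rfl) x) =
      Sum.map (Fin.castAdd b'.len) (Port.map Sum.inl fun _ => rfl) (F.strand x) := by
  have : ∀ y : Terminus Γ b F.type, (Equiv.sumCongr finSumFinEquiv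
      (Port.sumEquiv fun p => Γ.numIn (Sum.elim F.type G.type p)).symm)
      ((Equiv.sumSumSumComm _ _ _ _).symm (.inl y : _ ⊕ Terminus Γ b' G.type)) =
      Sum.map (Fin.castAdd b'.len) (Port.map Sum.inl fun _ => rfl) y := by
    rintro (_ | _) <;> rfl
  rw [← this]
  rcases x with i | x
  · exact congrArg (fun z => ((Equiv.sumSumSumComm _ _ _ _).trans <|
      (Equiv.sumCongr F.strand G.strand).trans <| (Equiv.sumSumSumComm _ _ _ _).symm.trans
      (Equiv.sumCongr finSumFinEquiv
        (Port.sumEquiv fun p => Γ.numIn (Sum.elim F.type G.type p)).symm)) (Sum.inl z))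
      (finSumFinEquiv_symm_apply_castAdd i)
  · rfl

theorem juxtaposeStrand_right (F : StrandDiagram Γ a b) (G : StrandDiagram Γ a' b')
    (x : Origin Γ a' G.type) :
    juxtaposeStrand F G (Sum.map (Fin.natAdd a.len) (Port.map Sum.inr fun _ => rfl) x) =
      Sum.map (Fin.natAdd b.len) (Port.map Sum.inr fun _ => rfl) (G.strand x) := by
  have : ∀ y : Terminus Γ b' G.type, (Equiv.sumCongr finSumFinEquiv
      (Port.sumEquiv fun p => Γ.numIn (Sum.elim F.type G.type p)).symm)
      ((Equiv.sumSumSumComm _ _ _ _).symm (.inr y : Terminus Γ b F.type ⊕ _)) =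
      Sum.map (Fin.natAdd b.len) (Port.map Sum.inr fun _ => rfl) y := by
    rintro (_ | _) <;> rfl
  rw [← this]
  rcases x with i | x
  · exact congrArg (fun z => ((Equiv.sumSumSumComm _ _ _ _).trans <|
      (Equiv.sumCongr F.strand G.strand).trans <| (Equiv.sumSumSumComm _ _ _ _).symm.trans
      (Equiv.sumCongr finSumFinEquiv
        (Port.sumEquiv fun p => Γ.numIn (Sum.elim F.type G.type p)).symm)) (Sum.inl z))
      (finSumFinEquiv_symm_apply_natAdd i)
  · rfl

/-- The juxtaposition of `F` and `G`, with `F` to the left of `G`. -/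
@[reducible]
def juxtapose (F : StrandDiagram Γ a b) (G : StrandDiagram Γ a' b') :
    StrandDiagram Γ (a.append a') (b.append b') where
  Pt := F.Pt ⊕ G.Pt
  finite := by have := F.finite; have := G.finite; infer_instance
  type := Sum.elim F.type G.type
  allowed := by rintro (p | q); exacts [F.allowed p, G.allowed q]
  strand := juxtaposeStrand F G
  color x := by
    have left : ∀ x : Origin Γ a F.type, terminusColor Γ (juxtaposeStrand F G
        (Sum.map (Fin.castAdd a'.len) (Port.map Sum.inl fun _ => rfl) x)) =
        originColor Γ x := by
      intro x
      rw [juxtaposeStrand_left, ← F.color x]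
      rcases F.strand x with j | y
      · simp [terminusColor, Tuple.append]
      · rfl
    have right : ∀ x : Origin Γ a' G.type, terminusColor Γ (juxtaposeStrand F G
        (Sum.map (Fin.natAdd a.len) (Port.map Sum.inr fun _ => rfl) x)) =
        originColor Γ x := by
      intro x
      rw [juxtaposeStrand_right, ← G.color x]
      rcases G.strand x with j | y
      · simp [terminusColor, Tuple.append]
      · rfl
    rcases x with i | ⟨p | q, i, h⟩
    · refine Fin.addCases (fun i => ?_) (fun i => ?_) i
      · exact (left (.inl i)).trans (by simp [originColor, Tuple.append])
      · exact (right (.inl i)).trans (by simp [originColor, Tuple.append])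
    · exact left (.inr ⟨p, i, h⟩)
    · exact right (.inr ⟨q, i, h⟩)
  acyclic := by
    have key : ∀ x y, Joined Γ (juxtaposeStrand F G) x y →
        Sum.LiftRel (Joined Γ F.strand) (Joined Γ G.strand) x y := by
      rintro _ _ ⟨⟨p | q, i, h⟩, y, rfl, rfl, hxy⟩
      · have e := (juxtaposeStrand_left F G (.inr ⟨p, i, h⟩)).symm.trans hxy
        rcases hF : F.strand (.inr ⟨p, i, h⟩) with j | z <;> rw [hF] at e
        · simp at e
        · obtain rfl := Sum.inr_injective e
          exact .inl ⟨_, z, rfl, rfl, hF⟩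
      · have e := (juxtaposeStrand_right F G (.inr ⟨q, i, h⟩)).symm.trans hxy
        rcases hG : G.strand (.inr ⟨q, i, h⟩) with j | z <;> rw [hG] at e
        · simp at e
        · obtain rfl := Sum.inr_injective e
          exact .inr ⟨_, z, rfl, rfl, hG⟩
    have key' : ∀ x y, Relation.TransGen (Joined Γ (juxtaposeStrand F G)) x y →
        Sum.LiftRel (Relation.TransGen (Joined Γ F.strand))
          (Relation.TransGen (Joined Γ G.strand)) x y := by
      intro x y h
      induction h with
      | single h => exact (key _ _ h).mono (fun _ _ => .single) (fun _ _ => .single)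
      | tail _ h ih =>
        rcases ih with ⟨ih⟩ | ⟨ih⟩ <;> rcases key _ _ h with ⟨h'⟩ | ⟨h'⟩
        · exact .inl (ih.tail h')
        · exact .inr (ih.tail h')
    rintro (p | q) h
    · rcases key' _ _ h with ⟨h⟩
      exact F.acyclic _ h
    · rcases key' _ _ h with _ | ⟨h⟩
      exact G.acyclic _ h

/-- The split diagram with a single split, of color `v`, surrounded by straight strands colored by
`l` to its left and by `m` to its right. -/
def splitDiagram (l : Tuple V) (v : V) (hv : 2 ≤ Γ.outDegree v) (m : Tuple V) :
    StrandDiagram Γ (l.append ((Tuple.single v).append m)) (l.append ((Γ.children v).append m)) :=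
  (id l).juxtapose ((caret v hv).juxtapose (id m))

/-- The merge diagram with a single merge, of color `v`, surrounded by straight strands colored by
`l` to its left and by `m` to its right. -/
def mergeDiagram (l : Tuple V) (v : V) (hv : 2 ≤ Γ.outDegree v) (m : Tuple V) :
    StrandDiagram Γ (l.append ((Γ.children v).append m)) (l.append ((Tuple.single v).append m)) :=
  (id l).juxtapose ((invertedCaret v hv).juxtapose (id m))

/-- The diagram `F` with its sources and sinks reordered: the `i`-th source (sink) of `F` becomes
the `σ i`-th source (`τ i`-th sink). -/
def reorder (F : StrandDiagram Γ a b) (σ : Fin a.len ≃ Fin a'.len) (τ : Fin b.len ≃ Fin b'.len)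
    (hσ : ∀ i, a'.col (σ i) = a.col i) (hτ : ∀ i, b'.col (τ i) = b.col i) :
    StrandDiagram Γ a' b' where
  Pt := F.Pt
  finite := F.finite
  type := F.type
  allowed := F.allowed
  strand := (Equiv.sumCongr σ.symm (Equiv.refl _)).trans <|
    F.strand.trans (Equiv.sumCongr τ (Equiv.refl _))
  color x := by
    have h1 : originColor Γ x = originColor Γ (Sum.map σ.symm _root_.id x : Origin Γ a F.type) := by
      rcases x with i | x
      · simp [originColor, ← hσ]
      · rfl
    rw [h1, ← F.color]
    change terminusColor Γ (Sum.map τ _root_.id (F.strand (Sum.map σ.symm _root_.id x))) = _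
    rcases F.strand (Sum.map σ.symm _root_.id x) with j | y
    · exact hτ j
    · rfl
  acyclic p hp := by
    refine F.acyclic p (Relation.TransGen.mono ?_ _ _ hp)
    rintro _ _ ⟨x, y, rfl, rfl, h⟩
    refine ⟨x, y, rfl, rfl, ?_⟩
    change Sum.map τ _root_.id (F.strand (.inr x)) = Sum.inr y at h
    rcases hF : F.strand (.inr x) with j | z <;> rw [hF] at h
    · simp at h
    · simpa using h

/-- The bijection that moves the first block of `n` positions past the next `l` positions. -/
def moveBlock (n l m : ℕ) : Fin (n + (l + m)) ≃ Fin (l + (n + m)) :=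
  finSumFinEquiv.symm.trans <|
  (Equiv.sumCongr (Equiv.refl _) finSumFinEquiv.symm).trans <|
  (Equiv.sumAssoc _ _ _).symm.trans <|
  (Equiv.sumCongr (Equiv.sumComm _ _) (Equiv.refl _)).trans <|
  (Equiv.sumAssoc _ _ _).trans <|
  (Equiv.sumCongr (Equiv.refl _) finSumFinEquiv).trans finSumFinEquiv

theorem col_moveBlock (a l m : Tuple V) (i : Fin (a.append (l.append m)).len) :
    (l.append (a.append m)).col (moveBlock a.len l.len m.len i) =
      (a.append (l.append m)).col i := by
  change Fin (a.len + (l.len + m.len)) at i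
  change Fin.append l.col (Fin.append a.col m.col) (moveBlock a.len l.len m.len i) =
    Fin.append a.col (Fin.append l.col m.col) i
  refine Fin.addCases (fun i => ?_) (fun i => ?_) i
  · simp [moveBlock]
  · refine Fin.addCases (fun i => ?_) (fun i => ?_) i <;> simp [moveBlock]

/-- The diagram obtained by inserting `N` into `R` in such a way that the sources and sinks of `N`
are consecutive, between the `l` part and the `m` part of those of `R`. -/
def insert (l m : Tuple V) (N : StrandDiagram Γ a a)
    (R : StrandDiagram Γ (l.append m) (l.append m)) :
    StrandDiagram Γ (l.append (a.append m)) (l.append (a.append m)) :=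
  (N.juxtapose R).reorder (moveBlock a.len l.len m.len) (moveBlock a.len l.len m.len)
    (col_moveBlock a l m) (col_moveBlock a l m)

/-- For a tuple `(v₁, …, v_d)`, the diagram with `k * d` straight strands whose sources and sinks
are colored `v₁, …, v_d, v₁, …, v_d, …, v₁, …, v_d`, in which every source is joined to the sink `d`
positions to its right, the last `d` sources being joined to the first `d` sinks.
When closed, it consists of `d` loops with `k` base points each. -/
def loops (k : ℕ) (a : Tuple V) : StrandDiagram Γ (a.copies k) (a.copies k) :=
  ofEquiv (finProdFinEquiv.symm.trans <|
    (Equiv.prodCongr (finRotate k) (Equiv.refl _)).trans finProdFinEquiv) fun i => by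
      have e := congrArg (fun x : Fin k × Fin a.len => a.col x.2)
        (Equiv.symm_apply_apply finProdFinEquiv
          (finRotate k (finProdFinEquiv.symm i).1, (finProdFinEquiv.symm i).2))
      exact e

/-! ### The groupoid -/

theorem map_inclO {A A' : StrandDiagram Γ a b} (B B' : StrandDiagram Γ b c) (f : A'.Pt → A.Pt)
    (g : B'.Pt → B.Pt) (hf : ∀ p, A.type (f p) = A'.type p) (h) (x : Origin Γ a A'.type) :
    mapOrigin (Sum.map f g) h (inclO A' B' x) = inclO A B (mapOrigin f hf x) := by
  rcases x with _ | _ <;> rfl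

theorem map_inclT {A A' : StrandDiagram Γ a b} (B B' : StrandDiagram Γ b c) (f : A'.Pt → A.Pt)
    (g : B'.Pt → B.Pt) (hg : ∀ p, B.type (g p) = B'.type p) (h) (x : Terminus Γ c B'.type) :
    mapTerminus (Sum.map f g) h (inclT A' B' x) = inclT A B (mapTerminus g hg x) := by
  rcases x with _ | _ <;> rfl

theorem map_contT_left {A A' : StrandDiagram Γ a b} (B : StrandDiagram Γ b c) (f : A'.Pt → A.Pt)
    (hf : ∀ p, A.type (f p) = A'.type p) (h) (x : Terminus Γ b A'.type) :
    mapTerminus (Sum.map f _root_.id) h (contT A' B x) = contT A B (mapTerminus f hf x) := by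
  rcases x with j | _
  · refine (map_inclT B B f _root_.id (fun _ => rfl) h _).trans ?_
    change _ = inclT A B (B.strand (.inl j))
    rcases B.strand (.inl j) with _ | _ <;> rfl
  · rfl

theorem Iso.comp_right {A A' : StrandDiagram Γ a b} (H : A.Iso A') (B : StrandDiagram Γ b c) :
    (A.comp B).Iso (A'.comp B) := by
  obtain ⟨f, h, hf, hs⟩ := H
  have h' : ∀ p, (A.comp B).type (Sum.map f _root_.id p) = (A'.comp B).type p := by
    rintro (p | p); exacts [h p, rfl]
  refine ⟨Sum.map f _root_.id, h', hf.sumMap Function.bijective_id, fun x => ?_⟩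
  induction x using origin_cases with
  | left x =>
    rw [map_inclO B B f _ h]
    refine (congrArg _ (compStrand_left ..)).trans <| (map_contT_left B f h h' _).trans ?_
    rw [hs]
    exact (compStrand_left ..).symm
  | right x =>
    refine (congrArg _ (compStrand_right ..)).trans <|
      (map_inclT B B f _root_.id (fun _ => rfl) h' _).trans ?_
    refine Eq.trans ?_ (compStrand_right A B x).symm
    rcases B.strand (.inr x) with _ | _ <;> rfl

theorem Bypass.comp_right {A A' : StrandDiagram Γ a b} {v w : A.Pt} (H : A.Bypass A' v w)
    (B : StrandDiagram Γ b c) : (A.comp B).Bypass (A'.comp B) (.inl v) (.inl w) := by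
  obtain ⟨f, h, hf, hr, hs⟩ := H
  have h' : ∀ p, (A.comp B).type (Sum.map f _root_.id p) = (A'.comp B).type p := by
    rintro (p | p); exacts [h p, rfl]
  refine ⟨Sum.map f _root_.id, h', hf.sumMap Function.injective_id, ?_, fun x => ?_⟩
  · ext (p | p)
    · have : p ∈ Set.range f ↔ p ∈ ({v, w} : Set _)ᶜ := by rw [hr]
      simpa [Sum.exists] using this
    · simp
  induction x using origin_cases with
  | left x =>
    rw [map_inclO B B f _ h]
    have e := (congrArg (mapTerminus (Sum.map f _root_.id) h') (compStrand_left A' B x)).trans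
      (map_contT_left B f h h' _)
    rcases hs x with hs | ⟨y, z, hy, hz, hyz, h1, h2⟩
    · left
      refine e.trans ?_
      rw [hs]
      exact (compStrand_left ..).symm
    · right
      refine ⟨y.map Sum.inl fun _ => rfl, z.map Sum.inl fun _ => rfl, congrArg _ hy,
        congrArg _ hz, hyz, ?_, e.trans ?_⟩
      · refine (compStrand_left ..).trans ?_
        rw [h1]
        rfl
      · rw [h2]
        exact (compStrand_left A B (.inr z)).symm
  | right x =>
    left
    refine (congrArg _ (compStrand_right ..)).trans <|
      (map_inclT B B f _root_.id (fun _ => rfl) h' _).trans ?_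
    refine Eq.trans ?_ (compStrand_right A B x).symm
    rcases B.strand (.inr x) with _ | _ <;> rfl

theorem Step.comp_right {A A' : StrandDiagram Γ a b} (H : A.Step A') (B : StrandDiagram Γ b c) :
    (A.comp B).Step (A'.comp B) := by
  rcases H with H | ⟨v, k, hv, H⟩ | ⟨v, w, k, hv, hw, hvw, H⟩ | ⟨v, w, k, hv, hw, hvw, H⟩
  · exact .inl (H.comp_right B)
  · exact .inr (.inl ⟨.inl v, k, hv, H.comp_right B⟩)
  · refine .inr (.inr (.inl ⟨.inl v, .inl w, k, hv, hw, ?_, H.comp_right B⟩))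
    rintro ⟨_, i, hi⟩ rfl
    obtain ⟨y, hy, hi', h⟩ := hvw ⟨v, i, hi⟩ rfl
    refine ⟨y.map Sum.inl fun _ => rfl, congrArg _ hy, hi', ?_⟩
    refine (compStrand_left A B (.inr ⟨v, i, hi⟩)).trans ?_
    rw [h]
    rfl
  · refine .inr (.inr (.inr ⟨.inl v, .inl w, k, hv, hw, ?_, H.comp_right B⟩))
    obtain ⟨x, y, rfl, rfl, h⟩ := hvw
    refine ⟨x.map Sum.inl fun _ => rfl, y.map Sum.inl fun _ => rfl, rfl, rfl, ?_⟩
    refine (compStrand_left A B (.inr x)).trans ?_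
    rw [h]
    rfl

theorem Iso.comp_left (A : StrandDiagram Γ a b) {B B' : StrandDiagram Γ b c} (H : B.Iso B') :
    (A.comp B).Iso (A.comp B') := by
  obtain ⟨f, h, hf, hs⟩ := H
  have h' : ∀ p, (A.comp B).type (Sum.map _root_.id f p) = (A.comp B').type p := by
    rintro (p | p); exacts [rfl, h p]
  refine ⟨Sum.map _root_.id f, h', Function.bijective_id.sumMap hf, fun x => ?_⟩
  induction x using origin_cases with
  | left x =>
    rw [map_inclO B B' _root_.id f (fun _ => rfl)]
    refine (congrArg _ (compStrand_left ..)).trans ?_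
    have hx : mapOrigin _root_.id (fun _ => rfl) x = x := by rcases x with _ | _ <;> rfl
    rw [hx]
    refine Eq.trans ?_ (compStrand_left A B x).symm
    rcases A.strand x with j | y
    · refine (map_inclT B B' _ f h h' _).trans ?_
      rw [hs]
      rfl
    · rfl
  | right x =>
    refine (congrArg _ (compStrand_right ..)).trans <| (map_inclT B B' _ f h h' _).trans ?_
    rw [hs]
    exact (compStrand_right A B (x.map f _)).symm

theorem Bypass.comp_left (A : StrandDiagram Γ a b) {B B' : StrandDiagram Γ b c} {v w : B.Pt}
    (H : B.Bypass B' v w) : (A.comp B).Bypass (A.comp B') (.inr v) (.inr w) := by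
  obtain ⟨f, h, hf, hr, hs⟩ := H
  have h' : ∀ p, (A.comp B).type (Sum.map _root_.id f p) = (A.comp B').type p := by
    rintro (p | p); exacts [rfl, h p]
  refine ⟨Sum.map _root_.id f, h', Function.injective_id.sumMap hf, ?_, fun x => ?_⟩
  · ext (p | p)
    · simp
    · have : p ∈ Set.range f ↔ p ∈ ({v, w} : Set _)ᶜ := by rw [hr]
      simpa [Sum.exists] using this
  have key : ∀ (x : Origin Γ b B'.type) (o : Origin Γ a (A.comp B).type)
      (t : Terminus Γ c (A.comp B').type), (A.comp B).strand o =
        inclT A B (B.strand (mapOrigin f h x)) → t = inclT A B' (B'.strand x) →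
      mapTerminus (Sum.map _root_.id f) h' t = (A.comp B).strand o ∨
      ∃ (y : Port fun p => Γ.numIn ((A.comp B).type p))
        (z : Port fun p => Γ.numOut ((A.comp B).type p)),
        y.pt = .inr v ∧ z.pt = .inr w ∧ y.idx = z.idx ∧
        (A.comp B).strand o = Sum.inr y ∧
        mapTerminus (Sum.map _root_.id f) h' t = (A.comp B).strand (Sum.inr z) := by
    rintro x o t ho rfl
    have e := map_inclT (A := A) B B' _root_.id f h h' (B'.strand x)
    rcases hs x with hs | ⟨y, z, hy, hz, hyz, h1, h2⟩
    · left
      rw [ho, ← hs]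
      exact e
    · right
      refine ⟨y.map Sum.inr fun _ => rfl, z.map Sum.inr fun _ => rfl, congrArg _ hy,
        congrArg _ hz, hyz, ?_, e.trans ?_⟩
      · rw [ho, h1]
        rfl
      · rw [h2]
        exact (compStrand_right A B z).symm
  induction x using origin_cases with
  | left x =>
    rw [map_inclO B B' _root_.id f (fun _ => rfl)]
    have hx : mapOrigin _root_.id (fun _ => rfl) x = x := by rcases x with _ | _ <;> rfl
    rw [hx]
    have e1 := compStrand_left A B x
    have e2 := compStrand_left A B' x
    rcases hA : A.strand x with j | y
    · rw [hA] at e1 e2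
      exact key (.inl j) _ _ e1 e2
    · left
      refine (congrArg _ e2).trans (Eq.trans ?_ e1.symm)
      rw [hA]
      rfl
  | right x =>
    exact key (.inr x) _ _ (compStrand_right A B (x.map f _)) (compStrand_right A B' x)

theorem Step.comp_left (A : StrandDiagram Γ a b) {B B' : StrandDiagram Γ b c} (H : B.Step B') :
    (A.comp B).Step (A.comp B') := by
  rcases H with H | ⟨v, k, hv, H⟩ | ⟨v, w, k, hv, hw, hvw, H⟩ | ⟨v, w, k, hv, hw, hvw, H⟩
  · exact .inl (H.comp_left A)
  · exact .inr (.inl ⟨.inr v, k, hv, H.comp_left A⟩)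
  · refine .inr (.inr (.inl ⟨.inr v, .inr w, k, hv, hw, ?_, H.comp_left A⟩))
    rintro ⟨_, i, hi⟩ rfl
    obtain ⟨y, hy, hi', h⟩ := hvw ⟨v, i, hi⟩ rfl
    refine ⟨y.map Sum.inr fun _ => rfl, congrArg _ hy, hi', ?_⟩
    refine (compStrand_right A B ⟨v, i, hi⟩).trans ?_
    rw [h]
    rfl
  · refine .inr (.inr (.inr ⟨.inr v, .inr w, k, hv, hw, ?_, H.comp_left A⟩))
    obtain ⟨x, y, rfl, rfl, h⟩ := hvw
    refine ⟨x.map Sum.inr fun _ => rfl, y.map Sum.inr fun _ => rfl, rfl, rfl, ?_⟩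
    refine (compStrand_right A B x).trans ?_
    rw [h]
    rfl

theorem comp_assoc_iso {d : Tuple V} (A : StrandDiagram Γ a b) (B : StrandDiagram Γ b c)
    (C : StrandDiagram Γ c d) : (A.comp (B.comp C)).Iso ((A.comp B).comp C) := by
  have h : ∀ p, (A.comp (B.comp C)).type (Equiv.sumAssoc A.Pt B.Pt C.Pt p) =
      ((A.comp B).comp C).type p := by
    rintro ((_ | _) | _) <;> rfl
  refine ⟨Equiv.sumAssoc _ _ _, h, (Equiv.sumAssoc _ _ _).bijective, fun x => ?_⟩
  have hC : ∀ t : Terminus Γ d C.type, mapTerminus (Equiv.sumAssoc A.Pt B.Pt C.Pt) h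
      (inclT (A.comp B) C t) = inclT A (B.comp C) (inclT B C t) := by
    rintro (_ | _) <;> rfl
  have hB : ∀ t : Terminus Γ c B.type, mapTerminus (Equiv.sumAssoc A.Pt B.Pt C.Pt) h
      (contT (A.comp B) C (inclT A B t)) = inclT A (B.comp C) (contT B C t) := by
    rintro (j | _)
    · exact hC _
    · rfl
  induction x using origin_cases with
  | left x =>
    refine (congrArg _ (compStrand_left (A.comp B) C x)).trans ?_
    induction x using origin_cases with
    | left x =>
      have e : mapOrigin (Equiv.sumAssoc A.Pt B.Pt C.Pt) h
          (inclO (A.comp B) C (inclO A B x)) = inclO A (B.comp C) x := by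
        rcases x with _ | _ <;> rfl
      refine Eq.trans ?_ (congrArg (A.comp (B.comp C)).strand e).symm
      refine Eq.trans ?_ (compStrand_left A (B.comp C) x).symm
      refine (congrArg (fun t => mapTerminus _ h (contT (A.comp B) C t))
        (compStrand_left A B x)).trans ?_
      rcases A.strand x with j | y
      · refine (hB _).trans ?_
        exact congrArg (inclT A (B.comp C)) (compStrand_left B C (.inl j)).symm
      · rfl
    | right x =>
      refine (congrArg (fun t => mapTerminus _ h (contT (A.comp B) C t))
        (compStrand_right A B x)).trans ?_
      refine (hB _).trans ?_
      refine Eq.trans ?_ (compStrand_right A (B.comp C) (x.map Sum.inl fun _ => rfl)).symm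
      exact congrArg (inclT A (B.comp C)) (compStrand_left B C (.inr x)).symm
  | right x =>
    refine (congrArg _ (compStrand_right (A.comp B) C x)).trans ?_
    refine (hC _).trans ?_
    refine Eq.trans ?_ (compStrand_right A (B.comp C) (x.map Sum.inr fun _ => rfl)).symm
    exact congrArg (inclT A (B.comp C)) (compStrand_right B C x).symm

theorem id_comp_iso (A : StrandDiagram Γ a b) : ((id a).comp A).Iso A := by
  refine ⟨Sum.inr, fun _ => rfl, ⟨Sum.inr_injective, ?_⟩, fun x => ?_⟩
  · rintro (p | p); exacts [p.elim, ⟨p, rfl⟩]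
  · rcases x with i | x
    · exact (compStrand_left (id a) A (.inl i)).symm
    · exact (compStrand_right (id a) A x).symm

theorem comp_id_iso (A : StrandDiagram Γ a b) : (A.comp (id b)).Iso A := by
  refine ⟨Sum.inl, fun _ => rfl, ⟨Sum.inl_injective, ?_⟩, fun x => ?_⟩
  · rintro (p | p); exacts [⟨p, rfl⟩, p.elim]
  · refine Eq.trans ?_ (compStrand_left A (id b) x).symm
    rcases A.strand x with j | y <;> rfl

/-- The class `[F]` of a diagram `F`, for the equivalence relation generated by isomorphisms and
reductions of types 0, 1 and 2. -/
def Class (Γ : OrderedGraph V E) (a b : Tuple V) := Quot (Step (Γ := Γ) (a := a) (b := b))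

/-- Composition of classes, `[F] [G] = [F G]`. -/
def Class.comp : Class Γ a b → Class Γ b c → Class Γ a c :=
  Quot.map₂ StrandDiagram.comp (fun A _ _ H => H.comp_left A) fun _ _ B H => H.comp_right B

end StrandDiagram

/-- The groupoid `𝒢(Γ)`: its objects are the finite tuples of vertices of `Γ`, its morphisms are the
classes of strand diagrams, and `f ≫ g` is the composition of `f` (first) and `g`. -/
def StrandGroupoid {V : Type u} {E : Type w} (_ : OrderedGraph V E) := Tuple V

open CategoryTheory in
instance {V : Type u} {E : Type w} (Γ : OrderedGraph V E) : Category (StrandGroupoid Γ) where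
  Hom a b := StrandDiagram.Class Γ a b
  id a := Quot.mk _ (StrandDiagram.id a)
  comp f g := f.comp g
  id_comp := by rintro a b ⟨A⟩; exact Quot.sound (.inl A.id_comp_iso)
  comp_id := by rintro a b ⟨A⟩; exact Quot.sound (.inl A.comp_id_iso)
  assoc := by
    rintro a b c d ⟨A⟩ ⟨B⟩ ⟨C⟩
    exact (Quot.sound (.inl (A.comp_assoc_iso B C))).symm

/-- The class `[F]` of a strand diagram, as an element of the groupoid. -/
def StrandDiagram.toClass {V : Type u} {E : Type w} {Γ : OrderedGraph V E} {a b : Tuple V}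
    (F : StrandDiagram Γ a b) : (show StrandGroupoid Γ from a) ⟶ (show StrandGroupoid Γ from b) :=
  Quot.mk _ F

open CategoryTheory in
/-- Conjugacy of two elements `f` and `g` with equal domain and range: `f = h g h⁻¹` for some
invertible element `h`. -/
def StrandGroupoid.Conjugate {V : Type u} {E : Type w} {Γ : OrderedGraph V E}
    {a b : StrandGroupoid Γ} (f : a ⟶ a) (g : b ⟶ b) : Prop :=
  ∃ h : a ≅ b, f = h.hom ≫ g ≫ h.inv

/-! ### Closed strand diagrams -/

/-- A `Γ`-closed strand diagram. Its points are the base points, which are linearly ordered (they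
are numbered by `Fin base.len`) and colored by `base`, and the splits, merges and degenerate points
in `Pt`. Every base point is the origin of exactly one strand and the terminus of exactly one
strand, so that the base points occur both among the origins and among the termini of the strands.
Every directed cycle goes through a base point. -/
structure ClosedStrandDiagram {V : Type u} {E : Type w} (Γ : OrderedGraph V E) where
  base : Tuple V
  Pt : Type
  finite : Finite Pt
  type : Pt → PointType V
  allowed : ∀ p, Γ.Allowed (type p)
  strand : Origin Γ base type ≃ Terminus Γ base type
  color : ∀ x, terminusColor Γ (strand x) = originColor Γ x
  acyclic : ∀ p, ¬ Relation.TransGen (Joined Γ strand) p p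

/-- The closed strand diagram `C(F)`: for every `i`, the `i`-th source and the `i`-th sink of `F`
are identified, and become the `i`-th base point. -/
def StrandDiagram.close {V : Type u} {E : Type w} {Γ : OrderedGraph V E} {a : Tuple V}
    (F : StrandDiagram Γ a a) : ClosedStrandDiagram Γ where
  base := a
  Pt := F.Pt
  finite := F.finite
  type := F.type
  allowed := F.allowed
  strand := F.strand
  color := F.color
  acyclic := F.acyclic

namespace ClosedStrandDiagram

variable {V : Type u} {E : Type w} {Γ : OrderedGraph V E}

/-- Base line shifts. If `F` is a diagram in which a source is immediately followed by a split, then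
`F = S R`, where `S` consists of this split (and straight strands), and moving the split from below
the source to below the corresponding sink yields `R S`. If consecutive sources of `F` are all of
the predecessors of a merge, then `F = M R`, where `M` consists of this merge, and moving the merge
to below the corresponding sinks yields `R M`. Similarly for merges above a sink (`F = R M` becomes
`M R`) and splits above consecutive sinks (`F = R S` becomes `S R`). -/
inductive Shift : ClosedStrandDiagram Γ → ClosedStrandDiagram Γ → Prop
  /-- Expanding shift of a split that follows a source. -/
  | expandSplit (l m : Tuple V) (v : V) (hv : 2 ≤ Γ.outDegree v)
      (R : StrandDiagram Γ (l.append ((Γ.children v).append m))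
        (l.append ((Tuple.single v).append m))) :
      Shift ((StrandDiagram.splitDiagram l v hv m).comp R).close
        (R.comp (StrandDiagram.splitDiagram l v hv m)).close
  /-- Expanding shift of a merge that precedes a sink. -/
  | expandMerge (l m : Tuple V) (v : V) (hv : 2 ≤ Γ.outDegree v)
      (R : StrandDiagram Γ (l.append ((Tuple.single v).append m))
        (l.append ((Γ.children v).append m))) :
      Shift (R.comp (StrandDiagram.mergeDiagram l v hv m)).close
        ((StrandDiagram.mergeDiagram l v hv m).comp R).close
  /-- Reducing shift of a merge that follows consecutive sources. -/
  | reduceMerge (l m : Tuple V) (v : V) (hv : 2 ≤ Γ.outDegree v)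
      (R : StrandDiagram Γ (l.append ((Tuple.single v).append m))
        (l.append ((Γ.children v).append m))) :
      Shift ((StrandDiagram.mergeDiagram l v hv m).comp R).close
        (R.comp (StrandDiagram.mergeDiagram l v hv m)).close
  /-- Reducing shift of a split that precedes consecutive sinks. -/
  | reduceSplit (l m : Tuple V) (v : V) (hv : 2 ≤ Γ.outDegree v)
      (R : StrandDiagram Γ (l.append ((Γ.children v).append m))
        (l.append ((Tuple.single v).append m))) :
      Shift (R.comp (StrandDiagram.splitDiagram l v hv m)).close
        ((StrandDiagram.splitDiagram l v hv m).comp R).close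

/-- Base line permutations: the base points are put in a different order. -/
inductive Permutation : ClosedStrandDiagram Γ → ClosedStrandDiagram Γ → Prop
  | permute {a a' : Tuple V} (F : StrandDiagram Γ a a) (σ : Fin a.len ≃ Fin a'.len)
      (hσ : ∀ i, a'.col (σ i) = a.col i) :
      Permutation F.close (F.reorder σ σ hσ hσ).close

/-- Reductions of types 0, 1 and 2 (and isomorphisms) of the underlying strand diagrams. -/
inductive Reduction012 : ClosedStrandDiagram Γ → ClosedStrandDiagram Γ → Prop
  | step {a : Tuple V} {F F' : StrandDiagram Γ a a} (h : F.Step F') :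
      Reduction012 F.close F'.close

/-- Type 3: let `e₁ < ⋯ < e_d` be the edges originating from a vertex `v`, and suppose that there
are `k * d` consecutive base points, between the base points colored by `l` and by `m`, that form
`d` loops of `k` points, where for every `j` the `j`-th loop is colored by `term e_j` and consists
of the `j`-th, `(j + d)`-th, `(j + 2d)`-th, … of these base points, in this order. These loops are
replaced by a single `v`-colored loop with `k` consecutive base points, in this order. `R` is the
remaining part of the diagram. -/
inductive Reduction3 : ClosedStrandDiagram Γ → ClosedStrandDiagram Γ → Prop
  | replace (l m : Tuple V) (v : V) (k : ℕ) (hk : 0 < k)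
      (R : StrandDiagram Γ (l.append m) (l.append m)) :
      Reduction3 (StrandDiagram.insert l m (StrandDiagram.loops k (Γ.children v)) R).close
        (StrandDiagram.insert l m (StrandDiagram.loops k (Tuple.single v)) R).close

/-- A similarity or a reduction. -/
def Move (C C' : ClosedStrandDiagram Γ) : Prop :=
  Shift C C' ∨ Permutation C C' ∨ Reduction012 C C' ∨ Reduction3 C C'

/-- Equivalence of closed strand diagrams: one is obtained from the other by finitely many
similarities, reductions and inverses of reductions. -/
def Equivalent (C C' : ClosedStrandDiagram Γ) : Prop := Relation.EqvGen Move C C'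

end ClosedStrandDiagram

end EdgeShift

namespace EdgeShift

open CategoryTheory

namespace StrandDiagram

variable {V : Type u} {E : Type w} {Γ : OrderedGraph V E} {a b c a' b' c' m : Tuple V}

/-! Closing a diagram behaves like a trace: it forgets where a cyclic product begins.

Everything rests on a factorization (`induction_elementary`): up to isomorphism and reductions,
every diagram is a product of permutations and of diagrams with a single split or a single merge.
Indeed, by acyclicity a nonempty diagram has a point without predecessors. All strands entering it
come from sources, so after a permutation of the sources it can be cut off at the top; degenerate
points disappear by type 0.

There are two consequences. Types 1 and 2 say that a split and a merge of the same color are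
mutually inverse, so every class is invertible (`isIso_toHom`), and conjugacy of `F` and `G` follows
from any diagram `K` with `[FK] = [KG]`. Moreover `C(FX)` and `C(XF)` are equivalent for all `F` and
`X` (`equivalent_comp_comm`): for elementary `F` this is a base line shift or permutation, and the
property passes to products.

If `[F] = h[G]h⁻¹` with `h = [H]` and `h⁻¹ = [K]`, then `C(F)` is equivalent to `C(HGK)`, hence to
`C(GKH)`, hence to `C(G)`. Type 3 is not needed in this direction.

Conversely, each move preserves the conjugacy class. A shift replaces `XR` by `RX`, a base line
permutation is a conjugation, and types 0, 1 and 2 do not change the class. In type 3 the diagram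
`loops` permutes `k` blocks of strands cyclically, and `k` parallel copies of any diagram can be
moved through it, since this only renumbers the copies (`loops_comp_copies_iso`). Hence `k` parallel
merges of color `v` intertwine the two sides when `v` has out-degree at least 2; for out-degree 1
the two sides coincide. -/

theorem Iso.refl (F : StrandDiagram Γ a b) : F.Iso F := by
  refine ⟨_root_.id, fun _ => rfl, Function.bijective_id, fun x => ?_⟩
  have hx : mapOrigin _root_.id (fun _ => rfl) x = x := by rcases x with _ | _ <;> rfl
  rw [hx]
  rcases F.strand x with _ | _ <;> rfl

/-- The tuple `a`, as an object of the groupoid. -/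
abbrev obj (Γ : OrderedGraph V E) (a : Tuple V) : StrandGroupoid Γ := a

/-- The class of a diagram, as a morphism of the groupoid. -/
def toHom (F : StrandDiagram Γ a b) : obj Γ a ⟶ obj Γ b := Quot.mk _ F

theorem Iso.toHom_eq {F G : StrandDiagram Γ a b} (h : F.Iso G) : F.toHom = G.toHom :=
  Quot.sound (.inl h)

theorem Step.toHom_eq {F G : StrandDiagram Γ a b} (h : F.Step G) : F.toHom = G.toHom :=
  Quot.sound h

theorem toHom_comp (F : StrandDiagram Γ a b) (G : StrandDiagram Γ b c) :
    (F.comp G).toHom = F.toHom ≫ G.toHom := rfl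

/-! ### Diagrams of permutations -/

theorem ofEquiv_comp_ofEquiv (σ : Fin a.len ≃ Fin b.len) (hσ : ∀ i, b.col (σ i) = a.col i)
    (τ : Fin b.len ≃ Fin c.len) (hτ : ∀ i, c.col (τ i) = b.col i) :
    ((ofEquiv σ hσ : StrandDiagram Γ a b).comp (ofEquiv τ hτ)).Iso
      (ofEquiv (σ.trans τ) fun i => (hτ _).trans (hσ i)) := by
  refine ⟨Empty.elim, fun p => p.elim, ⟨fun p => p.elim, ?_⟩, ?_⟩
  · rintro (p | p) <;> exact p.elim
  · rintro (i | x)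
    · exact (compStrand_left (ofEquiv σ hσ : StrandDiagram Γ a b) (ofEquiv τ hτ) (.inl i)).symm
    · exact x.pt.elim

theorem col_symm {σ : Fin a.len ≃ Fin b.len} (h : ∀ i, b.col (σ i) = a.col i) (i) :
    a.col (σ.symm i) = b.col i := by
  rw [← h, σ.apply_symm_apply]

/-- The permutation diagrams on both sides contribute no points, so the points of the composition
are those of `F`, in the middle summand. This turns reordering into algebra in the groupoid. -/
theorem reorder_iso (F : StrandDiagram Γ a b) (σ : Fin a.len ≃ Fin a'.len)
    (τ : Fin b.len ≃ Fin b'.len) (hσ : ∀ i, a'.col (σ i) = a.col i)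
    (hτ : ∀ i, b'.col (τ i) = b.col i) :
    ((ofEquiv σ.symm (col_symm hσ)).comp (F.comp (ofEquiv τ hτ))).Iso (F.reorder σ τ hσ hτ) := by
  refine ⟨fun p => .inr (.inl p), fun _ => rfl,
    ⟨fun p q h => Sum.inl_injective (Sum.inr_injective h), ?_⟩, ?_⟩
  · rintro (p | p | p)
    exacts [p.elim, ⟨p, rfl⟩, p.elim]
  have key : ∀ y : Terminus Γ b F.type, mapTerminus (fun p => Sum.inr (Sum.inl p))
      (fun _ => rfl) (Sum.map τ _root_.id y : Terminus Γ b' F.type) =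
      inclT (ofEquiv σ.symm (col_symm hσ)) (F.comp (ofEquiv τ hτ)) (contT F (ofEquiv τ hτ) y) := by
    rintro (_ | _) <;> rfl
  rintro (i | x)
  · refine (key (F.strand (.inl (σ.symm i)))).trans ?_
    refine Eq.trans ?_ (compStrand_left (ofEquiv σ.symm (col_symm hσ))
      (F.comp (ofEquiv τ hτ)) (.inl i)).symm
    exact congrArg (inclT _ _) (compStrand_left F (ofEquiv τ hτ) (.inl (σ.symm i))).symm
  · refine (key (F.strand (.inr x))).trans ?_
    refine Eq.trans ?_ (compStrand_right (ofEquiv σ.symm (col_symm hσ))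
      (F.comp (ofEquiv τ hτ)) (x.map Sum.inl fun _ => rfl)).symm
    exact congrArg (inclT _ _) (compStrand_left F (ofEquiv τ hτ) (.inr x)).symm

theorem ofEquiv_comp_symm (σ : Fin a.len ≃ Fin b.len) (h : ∀ i, b.col (σ i) = a.col i) :
    ((ofEquiv σ h : StrandDiagram Γ a b).comp (ofEquiv σ.symm (col_symm h))).toHom =
      (id a).toHom := by
  rw [(ofEquiv_comp_ofEquiv ..).toHom_eq]
  congr 2
  exact σ.self_trans_symm

theorem ofEquiv_symm_comp (σ : Fin a.len ≃ Fin b.len) (h : ∀ i, b.col (σ i) = a.col i) :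
    ((ofEquiv σ.symm (col_symm h) : StrandDiagram Γ b a).comp (ofEquiv σ h)).toHom =
      (id b).toHom := by
  rw [(ofEquiv_comp_ofEquiv ..).toHom_eq]
  congr 2
  exact σ.symm_trans_self

/-- The isomorphism of the groupoid that is given by a permutation. -/
def permIso (σ : Fin a.len ≃ Fin b.len) (h : ∀ i, b.col (σ i) = a.col i) :
    obj Γ a ≅ obj Γ b where
  hom := (ofEquiv σ h).toHom
  inv := (ofEquiv σ.symm (col_symm h)).toHom
  hom_inv_id := ofEquiv_comp_symm σ h
  inv_hom_id := ofEquiv_symm_comp σ h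

theorem toHom_reorder (F : StrandDiagram Γ a b) (σ : Fin a.len ≃ Fin a'.len)
    (τ : Fin b.len ≃ Fin b'.len) (hσ : ∀ i, a'.col (σ i) = a.col i)
    (hτ : ∀ i, b'.col (τ i) = b.col i) :
    (F.reorder σ τ hσ hτ).toHom = (permIso σ hσ).inv ≫ F.toHom ≫ (permIso τ hτ).hom :=
  (reorder_iso F σ τ hσ hτ).toHom_eq.symm

/-- Reordering multiplies by permutations on both sides, and the inner ones cancel in each product.
It serves to carry an intertwiner over to `insert`, which is a reordered juxtaposition. -/
theorem intertwine_reorder {F : StrandDiagram Γ a a} {G : StrandDiagram Γ b b}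
    {K : StrandDiagram Γ a b} (h : (F.comp K).toHom = (K.comp G).toHom)
    (σ : Fin a.len ≃ Fin a'.len) (τ : Fin b.len ≃ Fin b'.len)
    (hσ : ∀ i, a'.col (σ i) = a.col i) (hτ : ∀ i, b'.col (τ i) = b.col i) :
    ((F.reorder σ σ hσ hσ).comp (K.reorder σ τ hσ hτ)).toHom =
      ((K.reorder σ τ hσ hτ).comp (G.reorder τ τ hτ hτ)).toHom := by
  rw [toHom_comp, toHom_comp] at h ⊢
  simp only [toHom_reorder, Category.assoc, Iso.hom_inv_id_assoc, reassoc_of% h]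

/-- Without points there are no ports, so `strand` is a bijection from sources to sinks. This is the
base case of the factorization. -/
theorem iso_ofEquiv_of_isEmpty (F : StrandDiagram Γ a b) [IsEmpty F.Pt] :
    ∃ (σ : Fin a.len ≃ Fin b.len) (h : ∀ i, b.col (σ i) = a.col i), F.Iso (ofEquiv σ h) := by
  have : IsEmpty (Port fun p => Γ.numOut (F.type p)) := ⟨fun x => isEmptyElim x.pt⟩
  have : IsEmpty (Port fun p => Γ.numIn (F.type p)) := ⟨fun x => isEmptyElim x.pt⟩
  let σ : Fin a.len ≃ Fin b.len :=
    (Equiv.sumEmpty _ _).symm.trans (F.strand.trans (Equiv.sumEmpty _ _))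
  have e : ∀ i, F.strand (.inl i) = .inl (σ i) := fun i =>
    ((Equiv.sumEmpty _ (Port fun p => Γ.numIn (F.type p))).symm_apply_apply _).symm
  refine ⟨σ, fun i => ?_, Empty.elim, fun p => p.elim, ⟨fun p => p.elim, isEmptyElim⟩, ?_⟩
  · have := F.color (.inl i)
    rwa [e] at this
  · rintro (i | x)
    · exact (e i).symm
    · exact x.pt.elim

/-! ### Juxtaposition -/

section Juxtapose

variable (F : StrandDiagram Γ a b) (G : StrandDiagram Γ a' b')

/-- Origins in `F`, regarded as origins in the juxtaposition. -/
def leftO : Origin Γ a F.type → Origin Γ (a.append a') (Sum.elim F.type G.type) :=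
  Sum.map (Fin.castAdd a'.len) (Port.map Sum.inl fun _ => rfl)

/-- Origins in `G`, regarded as origins in the juxtaposition. -/
def rightO : Origin Γ a' G.type → Origin Γ (a.append a') (Sum.elim F.type G.type) :=
  Sum.map (Fin.natAdd a.len) (Port.map Sum.inr fun _ => rfl)

/-- Termini in `F`, regarded as termini in the juxtaposition. -/
def leftT : Terminus Γ b F.type → Terminus Γ (b.append b') (Sum.elim F.type G.type) :=
  Sum.map (Fin.castAdd b'.len) (Port.map Sum.inl fun _ => rfl)

/-- Termini in `G`, regarded as termini in the juxtaposition. -/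
def rightT : Terminus Γ b' G.type → Terminus Γ (b.append b') (Sum.elim F.type G.type) :=
  Sum.map (Fin.natAdd b.len) (Port.map Sum.inr fun _ => rfl)

theorem juxtapose_strand_leftO (x : Origin Γ a F.type) :
    (F.juxtapose G).strand (leftO F G x) = leftT F G (F.strand x) :=
  juxtaposeStrand_left F G x

theorem juxtapose_strand_rightO (x : Origin Γ a' G.type) :
    (F.juxtapose G).strand (rightO F G x) = rightT F G (G.strand x) :=
  juxtaposeStrand_right F G x

theorem juxtapose_origin_cases
    {motive : Origin Γ (a.append a') (Sum.elim F.type G.type) → Prop}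
    (left : ∀ x, motive (leftO F G x)) (right : ∀ x, motive (rightO F G x)) (x) : motive x := by
  rcases x with i | ⟨p | q, i, h⟩
  · exact Fin.addCases (fun i => left (.inl i)) (fun i => right (.inl i)) i
  · exact left (.inr ⟨p, i, h⟩)
  · exact right (.inr ⟨q, i, h⟩)

end Juxtapose

theorem Iso.juxtapose {F F' : StrandDiagram Γ a b} {G G' : StrandDiagram Γ a' b'}
    (hF : F.Iso F') (hG : G.Iso G') : (F.juxtapose G).Iso (F'.juxtapose G') := by
  obtain ⟨f, h, hf, hs⟩ := hF
  obtain ⟨g, k, hg, ht⟩ := hG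
  have hk : ∀ p, (F.juxtapose G).type (Sum.map f g p) = (F'.juxtapose G').type p := by
    rintro (p | p); exacts [h p, k p]
  refine ⟨Sum.map f g, hk, hf.sumMap hg, fun x => ?_⟩
  induction x using juxtapose_origin_cases with
  | left x =>
    have e : mapOrigin (Sum.map f g) hk (leftO F' G' x) = leftO F G (mapOrigin f h x) := by
      rcases x with _ | _ <;> rfl
    rw [e, juxtapose_strand_leftO, juxtapose_strand_leftO, ← hs]
    rcases F'.strand x with _ | _ <;> rfl
  | right x =>
    have e : mapOrigin (Sum.map f g) hk (rightO F' G' x) = rightO F G (mapOrigin g k x) := by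
      rcases x with _ | _ <;> rfl
    rw [e, juxtapose_strand_rightO, juxtapose_strand_rightO, ← ht]
    rcases G'.strand x with _ | _ <;> rfl

/-- Both sides consist of the same four diagrams, and only the bracketing of the point set differs.
It reduces intertwining of juxtapositions to the two factors. -/
theorem interchange_iso (A : StrandDiagram Γ a b) (A' : StrandDiagram Γ b c)
    (B : StrandDiagram Γ a' b') (B' : StrandDiagram Γ b' c') :
    ((A.juxtapose B).comp (A'.juxtapose B')).Iso ((A.comp A').juxtapose (B.comp B')) := by
  have h : ∀ p, ((A.juxtapose B).comp (A'.juxtapose B')).type (Equiv.sumSumSumComm _ _ _ _ p) =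
      ((A.comp A').juxtapose (B.comp B')).type p := by
    rintro ((_ | _) | (_ | _)) <;> rfl
  refine ⟨Equiv.sumSumSumComm _ _ _ _, h, Equiv.bijective _, fun x => ?_⟩
  have hl : ∀ t : Terminus Γ c A'.type, mapTerminus _ h (leftT (A.comp A') (B.comp B')
      (inclT A A' t)) = inclT (A.juxtapose B) (A'.juxtapose B') (leftT A' B' t) := by
    rintro (_ | _) <;> rfl
  have hr : ∀ t : Terminus Γ c' B'.type, mapTerminus _ h (rightT (A.comp A') (B.comp B')
      (inclT B B' t)) = inclT (A.juxtapose B) (A'.juxtapose B') (rightT A' B' t) := by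
    rintro (_ | _) <;> rfl
  induction x using juxtapose_origin_cases with
  | left x =>
    rw [juxtapose_strand_leftO]
    induction x using origin_cases with
    | left x =>
      have e : mapOrigin _ h (leftO (A.comp A') (B.comp B') (inclO A A' x)) =
          inclO (A.juxtapose B) (A'.juxtapose B') (leftO A B x) := by
        rcases x with _ | _ <;> rfl
      rw [e, compStrand_left A A' x, compStrand_left (A.juxtapose B) (A'.juxtapose B'),
        juxtapose_strand_leftO]
      rcases A.strand x with j | y
      · exact (hl _).trans
          (congrArg (inclT _ _) (juxtapose_strand_leftO A' B' (.inl j)).symm)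
      · rfl
    | right x =>
      rw [compStrand_right A A' x, hl, ← juxtapose_strand_leftO]
      exact (compStrand_right (A.juxtapose B) (A'.juxtapose B')
        (x.map Sum.inl fun _ => rfl)).symm
  | right x =>
    rw [juxtapose_strand_rightO]
    induction x using origin_cases with
    | left x =>
      have e : mapOrigin _ h (rightO (A.comp A') (B.comp B') (inclO B B' x)) =
          inclO (A.juxtapose B) (A'.juxtapose B') (rightO A B x) := by
        rcases x with _ | _ <;> rfl
      rw [e, compStrand_left B B' x, compStrand_left (A.juxtapose B) (A'.juxtapose B'),
        juxtapose_strand_rightO]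
      rcases B.strand x with j | y
      · exact (hr _).trans
          (congrArg (inclT _ _) (juxtapose_strand_rightO A' B' (.inl j)).symm)
      · rfl
    | right x =>
      rw [compStrand_right B B' x, hr, ← juxtapose_strand_rightO]
      exact (compStrand_right (A.juxtapose B) (A'.juxtapose B')
        (x.map Sum.inr fun _ => rfl)).symm

/-! ### Copies of a diagram -/

/-- The ports at `k` copies of a set of points. -/
def prodPort {P : Type} (k : ℕ) (n : P → ℕ) :
    Fin k × Port n ≃ Port fun p : Fin k × P => n p.2 where
  toFun x := ⟨(x.1, x.2.pt), x.2.idx, x.2.lt⟩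
  invFun x := (x.pt.1, ⟨x.pt.2, x.idx, x.lt⟩)
  left_inv _ := rfl
  right_inv _ := rfl

/-- The origins of strands in `k` copies of a diagram. -/
def copyO {P : Type} (k : ℕ) (a : Tuple V) (type : P → PointType V) :
    Fin k × Origin Γ a type ≃ Origin Γ (a.copies k) fun p : Fin k × P => type p.2 :=
  (Equiv.prodSumDistrib _ _ _).trans (Equiv.sumCongr finProdFinEquiv (prodPort k _))

/-- The termini of strands in `k` copies of a diagram. -/
def copyT {P : Type} (k : ℕ) (a : Tuple V) (type : P → PointType V) :
    Fin k × Terminus Γ a type ≃ Terminus Γ (a.copies k) fun p : Fin k × P => type p.2 :=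
  (Equiv.prodSumDistrib _ _ _).trans (Equiv.sumCongr finProdFinEquiv (prodPort k _))

/-- The juxtaposition of `k` copies of `F`. -/
@[reducible]
def copies (k : ℕ) (F : StrandDiagram Γ a b) : StrandDiagram Γ (a.copies k) (b.copies k) where
  Pt := Fin k × F.Pt
  finite := by have := F.finite; infer_instance
  type p := F.type p.2
  allowed p := F.allowed p.2
  strand := (copyO k a F.type).symm.trans
    ((Equiv.prodCongr (Equiv.refl _) F.strand).trans (copyT k b F.type))
  color x := by
    obtain ⟨⟨j, x⟩, rfl⟩ := (copyO k a F.type).surjective x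
    have hO : originColor Γ (copyO k a F.type (j, x)) = originColor Γ x := by
      rcases x with i | x
      · exact congrArg (fun z : Fin k × Fin a.len => a.col z.2)
          (finProdFinEquiv.symm_apply_apply (j, i))
      · rfl
    have hT : ∀ y, terminusColor Γ (copyT k b F.type (j, y)) = terminusColor Γ y := by
      rintro (i | y)
      · exact congrArg (fun z : Fin k × Fin b.len => b.col z.2)
          (finProdFinEquiv.symm_apply_apply (j, i))
      · rfl
    rw [hO, ← F.color, ← hT]
    simp
  acyclic p hp := by
    -- A cycle among the copies projects to a cycle in `F`.
    refine F.acyclic p.2 (Relation.TransGen.lift Prod.snd ?_ _ _ hp)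
    rintro _ _ ⟨⟨⟨j, p⟩, i, hi⟩, y, rfl, rfl, h⟩
    change copyT k b F.type (j, F.strand (.inr ⟨p, i, hi⟩)) = _ at h
    rcases hF : F.strand (.inr ⟨p, i, hi⟩) with q | z <;> rw [hF] at h
    · cases h
    · obtain rfl := Sum.inr_injective h
      exact ⟨_, z, rfl, rfl, hF⟩

theorem copies_strand (k : ℕ) (F : StrandDiagram Γ a b) (j : Fin k) (x : Origin Γ a F.type) :
    (F.copies k).strand (copyO k a F.type (j, x)) = copyT k b F.type (j, F.strand x) := by
  simp

theorem loops_strand (k : ℕ) (a : Tuple V) (j : Fin k) (i : Fin a.len) :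
    (loops k a : StrandDiagram Γ _ _).strand (.inl (finProdFinEquiv (j, i))) =
      .inl (finProdFinEquiv (finRotate k j, i)) :=
  congrArg (fun z : Fin k × Fin a.len => Sum.inl (finProdFinEquiv (finRotate k z.1, z.2)))
    (finProdFinEquiv.symm_apply_apply (j, i))

/-- `loops` moves each block of strands to the next one cyclically and keeps the positions within a
block. Since all copies of `F` are equal, passing them through it only rotates their numbering.
Applied to a merge, this is the reason why type 3 reductions preserve conjugacy. -/
theorem loops_comp_copies_iso (k : ℕ) (F : StrandDiagram Γ a b) :
    ((loops k a).comp (F.copies k)).Iso ((F.copies k).comp (loops k b)) := by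
  -- a point in the `j`-th copy on the right corresponds to one in the next copy on the left
  let f : ((F.copies k).comp (loops (Γ := Γ) k b)).Pt →
      ((loops (Γ := Γ) k a).comp (F.copies k)).Pt :=
    Sum.elim (fun p => .inr (finRotate k p.1, p.2)) Empty.elim
  have h : ∀ p, ((loops (Γ := Γ) k a).comp (F.copies k)).type (f p) =
      ((F.copies k).comp (loops k b)).type p := by
    rintro (p | p); exacts [rfl, p.elim]
  -- A strand ending at a sink of the `j`-th copy is continued by `loops` to the same position in
  -- the next block; a strand ending at a point is only renumbered.
  have hT : ∀ j t, mapTerminus f h (contT (F.copies k) (loops k b) (copyT k b F.type (j, t))) =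
      inclT (loops k a) (F.copies k) (copyT k b F.type (finRotate k j, t)) := by
    rintro j (i | t)
    · change mapTerminus f h (inclT (F.copies k) (loops k b)
        ((loops k b).strand (.inl (finProdFinEquiv (j, i))))) = _
      rw [loops_strand]
      rfl
    · rfl
  refine ⟨f, h, ⟨?_, ?_⟩, fun x => ?_⟩
  · rintro (p | p) (q | q) e
    · have e := Sum.inr_injective e
      simp only [Prod.mk.injEq, EmbeddingLike.apply_eq_iff_eq] at e
      rw [Prod.ext e.1 e.2]
    all_goals first | exact p.elim | exact q.elim
  · rintro (p | ⟨j, p⟩)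
    · exact p.elim
    · exact ⟨.inl ((finRotate k).symm j, p),
        congrArg (fun i => Sum.inr (i, p)) ((finRotate k).apply_symm_apply j)⟩
  induction x using origin_cases with
  | left x =>
    obtain ⟨⟨j, x⟩, rfl⟩ := (copyO k a F.type).surjective x
    rw [compStrand_left (F.copies k) (loops k b), copies_strand, hT, ← copies_strand]
    rcases x with i | x
    · refine Eq.trans ?_ (compStrand_left (loops k a) (F.copies k)
        (.inl (finProdFinEquiv (j, i)))).symm
      rw [loops_strand]
      rfl
    · exact (compStrand_right (loops k a) (F.copies k)
        (prodPort k (fun p => Γ.numOut (F.type p)) (finRotate k j, x))).symm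
  | right x => exact x.pt.elim

/-- Diagrams that intertwine the inserted diagrams also intertwine the results of the insertion. -/
theorem exists_intertwine_insert (l m : Tuple V) {N : StrandDiagram Γ a a}
    {N' : StrandDiagram Γ b b} (K : StrandDiagram Γ a b) (h : (N.comp K).Iso (K.comp N'))
    (R : StrandDiagram Γ (l.append m) (l.append m)) :
    ∃ K' : StrandDiagram Γ (l.append (a.append m)) (l.append (b.append m)),
      ((insert l m N R).comp K').toHom = (K'.comp (insert l m N' R)).toHom := by
  -- Before reordering, the intertwiner is `K` beside straight strands: by interchange, both
  -- products equal `K N'` beside `R`.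
  have e : ((N.juxtapose R).comp (K.juxtapose (id _))).toHom =
      ((K.juxtapose (id _)).comp (N'.juxtapose R)).toHom := by
    rw [(interchange_iso ..).toHom_eq, (interchange_iso ..).toHom_eq,
      (h.juxtapose R.comp_id_iso).toHom_eq,
      ((Iso.refl (K.comp N')).juxtapose R.id_comp_iso).toHom_eq]
  exact ⟨_, intertwine_reorder e _ _ _ (col_moveBlock b l m)⟩

/-! ### Diagrams with a single point -/

/-- The colors of the strands terminating at a point. -/
@[reducible]
def inTuple (Γ : OrderedGraph V E) (t : PointType V) : Tuple V := ⟨Γ.numIn t, Γ.inColor t⟩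

/-- The colors of the strands originating from a point. -/
@[reducible]
def outTuple (Γ : OrderedGraph V E) (t : PointType V) : Tuple V := ⟨Γ.numOut t, Γ.outColor t⟩

/-- The diagram with a single point. -/
def pointDiagram (t : PointType V) (ht : Γ.Allowed t) :
    StrandDiagram Γ (inTuple Γ t) (outTuple Γ t) where
  Pt := Unit
  finite := inferInstance
  type _ := t
  allowed _ := ht
  strand :=
    { toFun := Sum.elim (fun i => .inr ⟨(), i.1, i.2⟩) fun x => .inl ⟨x.idx, x.lt⟩
      invFun := Sum.elim (fun i => .inr ⟨(), i.1, i.2⟩) fun x => .inl ⟨x.idx, x.lt⟩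
      left_inv := by rintro (i | x) <;> rfl
      right_inv := by rintro (i | x) <;> rfl }
  color := by rintro (i | x) <;> rfl
  acyclic p hp := by
    obtain ⟨_, ⟨x, y, -, -, h⟩, -⟩ := Relation.TransGen.head'_iff.1 hp
    simp at h

/-- `pointDiagram` treats all kinds of points uniformly, whereas shifts are stated with `caret`. The
domains and ranges agree by definition, which is why they are given explicitly. -/
theorem pointDiagram_split_iso (v : V) (hv : 2 ≤ Γ.outDegree v) :
    Iso (a := Tuple.single v) (b := Γ.children v) (pointDiagram (.split v) hv) (caret v hv) := by
  refine ⟨_root_.id, fun _ => rfl, Function.bijective_id, ?_⟩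
  rintro (i | x)
  · obtain rfl : i = (0 : Fin 1) := Subsingleton.elim (α := Fin 1) _ _
    rfl
  · rfl

theorem pointDiagram_merge_iso (v : V) (hv : 2 ≤ Γ.outDegree v) :
    Iso (a := Γ.children v) (b := Tuple.single v) (pointDiagram (.merge v) hv)
      (invertedCaret v hv) := by
  refine ⟨_root_.id, fun _ => rfl, Function.bijective_id, ?_⟩
  rintro (i | ⟨_, i, h⟩)
  · rfl
  · obtain rfl : i = 0 := Nat.lt_one_iff.1 h
    rfl

/-! ### Cancellation -/

/-- The common form of the cancellations of types 0, 1 and 2 that leave no points: every source is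
already joined to its own sink, or becomes so once the strands at `v` and `w` are attached. -/
theorem bypass_id {F : StrandDiagram Γ a a} {v w : F.Pt} (hvw : ∀ p, p = v ∨ p = w)
    (h : ∀ i, F.strand (.inl i) = .inl i ∨
      ∃ (y : Port fun p => Γ.numIn (F.type p)) (z : Port fun p => Γ.numOut (F.type p)),
        y.pt = v ∧ z.pt = w ∧ y.idx = z.idx ∧
        F.strand (.inl i) = .inr y ∧ F.strand (.inr z) = .inl i) :
    F.Bypass (id a) v w := by
  refine ⟨Empty.elim, fun p => p.elim, fun p => p.elim, ?_, ?_⟩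
  · ext p
    exact ⟨fun ⟨q, _⟩ => q.elim, fun h => (h (hvw p)).elim⟩
  · rintro (i | x)
    · refine (h i).imp Eq.symm ?_
      rintro ⟨y, z, hy, hz, hyz, h1, h2⟩
      exact ⟨y, z, hy, hz, hyz, h1, h2.symm⟩
    · exact x.pt.elim

section Elementary

variable (l m : Tuple V) (v : V) (hv : 2 ≤ Γ.outDegree v)

theorem splitDiagram_strand_left (i : Fin l.len) :
    (splitDiagram l v hv m).strand (.inl (Fin.castAdd _ i)) = .inl (Fin.castAdd _ i) :=
  juxtapose_strand_leftO (id l) ((caret v hv).juxtapose (id m)) (.inl i)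

theorem splitDiagram_strand_mid (x : Origin Γ (Tuple.single v) (caret v hv).type) :
    (splitDiagram l v hv m).strand (rightO (id l) ((caret v hv).juxtapose (id m))
      (leftO (caret v hv) (id m) x)) = rightT (id l) ((caret v hv).juxtapose (id m))
      (leftT (caret v hv) (id m) ((caret v hv).strand x)) :=
  (juxtapose_strand_rightO (id l) ((caret v hv).juxtapose (id m)) _).trans
    (congrArg _ (juxtapose_strand_leftO (caret v hv) (id m) x))

theorem splitDiagram_strand_right (i : Fin m.len) :
    (splitDiagram l v hv m).strand (.inl (Fin.natAdd _ (Fin.natAdd _ i))) =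
      .inl (Fin.natAdd _ (Fin.natAdd _ i)) :=
  (juxtapose_strand_rightO (id l) ((caret v hv).juxtapose (id m)) (.inl (Fin.natAdd _ i))).trans
    (congrArg _ (juxtapose_strand_rightO (caret v hv) (id m) (.inl i)))

theorem mergeDiagram_strand_left (i : Fin l.len) :
    (mergeDiagram l v hv m).strand (.inl (Fin.castAdd _ i)) = .inl (Fin.castAdd _ i) :=
  juxtapose_strand_leftO (id l) ((invertedCaret v hv).juxtapose (id m)) (.inl i)

theorem mergeDiagram_strand_mid (x : Origin Γ (Γ.children v) (invertedCaret v hv).type) :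
    (mergeDiagram l v hv m).strand (rightO (id l) ((invertedCaret v hv).juxtapose (id m))
      (leftO (invertedCaret v hv) (id m) x)) = rightT (id l) ((invertedCaret v hv).juxtapose (id m))
      (leftT (invertedCaret v hv) (id m) ((invertedCaret v hv).strand x)) :=
  (juxtapose_strand_rightO (id l) ((invertedCaret v hv).juxtapose (id m)) _).trans
    (congrArg _ (juxtapose_strand_leftO (invertedCaret v hv) (id m) x))

theorem mergeDiagram_strand_right (i : Fin m.len) :
    (mergeDiagram l v hv m).strand (.inl (Fin.natAdd _ (Fin.natAdd _ i))) =
      .inl (Fin.natAdd _ (Fin.natAdd _ i)) :=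
  (juxtapose_strand_rightO (id l) ((invertedCaret v hv).juxtapose (id m))
    (.inl (Fin.natAdd _ i))).trans
    (congrArg _ (juxtapose_strand_rightO (invertedCaret v hv) (id m) (.inl i)))

theorem split_comp_merge :
    ((splitDiagram l v hv m).comp (mergeDiagram l v hv m)).toHom = (id _).toHom := by
  have hl := compStrand_left (splitDiagram l v hv m) (mergeDiagram l v hv m)
  have hr := compStrand_right (splitDiagram l v hv m) (mergeDiagram l v hv m)
  -- A reduction of type 1: `.inl (.inr (.inl ()))` is the split in the upper factor and `.inr (.inr
  -- (.inl ()))` the merge in the lower one. The straight strands contribute no points.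
  refine Step.toHom_eq (.inr (.inr (.inl
    ⟨.inl (.inr (.inl ())), .inr (.inr (.inl ())), v, rfl, rfl, ?_, bypass_id ?_ ?_⟩)))
  · rintro ⟨_, i, hi⟩ rfl
    refine ⟨⟨.inr (.inr (.inl ())), i, hi⟩, rfl, rfl, (hl (.inr ⟨.inr (.inl ()), i, hi⟩)).trans ?_⟩
    refine (congrArg (contT _ _) (splitDiagram_strand_mid l m v hv (.inr ⟨(), i, hi⟩))).trans ?_
    exact congrArg (inclT _ _) (mergeDiagram_strand_mid l m v hv (.inl ⟨i, hi⟩))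
  · rintro ((p | p | p) | (p | p | p))
    exacts [p.elim, .inl rfl, p.elim, p.elim, .inr rfl, p.elim]
  · intro i
    refine Fin.addCases (fun i => ?_) (fun i => ?_) i
    · left
      refine (hl (.inl _)).trans ?_
      refine (congrArg (contT _ _) (splitDiagram_strand_left l m v hv i)).trans ?_
      exact congrArg (inclT _ _) (mergeDiagram_strand_left l m v hv i)
    · refine Fin.addCases (fun i => ?_) (fun i => ?_) i
      -- The unique source above the split: its strand is attached to the one leaving the merge.
      · right
        obtain rfl : i = (0 : Fin 1) := Subsingleton.elim (α := Fin 1) _ _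
        refine ⟨⟨.inl (.inr (.inl ())), 0, Nat.zero_lt_one⟩, ⟨.inr (.inr (.inl ())), 0,
          Nat.zero_lt_one⟩, rfl, rfl, rfl, (hl (.inl _)).trans ?_, ?_⟩
        · exact congrArg (contT _ _) (splitDiagram_strand_mid l m v hv (.inl (0 : Fin 1)))
        · refine (hr ⟨.inr (.inl ()), 0, Nat.zero_lt_one⟩).trans ?_
          exact congrArg (inclT _ _)
            (mergeDiagram_strand_mid l m v hv (.inr ⟨(), 0, Nat.zero_lt_one⟩))
      · left
        refine (hl (.inl _)).trans ?_
        refine (congrArg (contT _ _) (splitDiagram_strand_right l m v hv i)).trans ?_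
        exact congrArg (inclT _ _) (mergeDiagram_strand_right l m v hv i)

theorem merge_comp_split :
    ((mergeDiagram l v hv m).comp (splitDiagram l v hv m)).toHom = (id _).toHom := by
  have hl := compStrand_left (mergeDiagram l v hv m) (splitDiagram l v hv m)
  have hr := compStrand_right (mergeDiagram l v hv m) (splitDiagram l v hv m)
  -- A reduction of type 2, now with the merge in the upper factor and the split in the lower one.
  refine Step.toHom_eq (.inr (.inr (.inr
    ⟨.inl (.inr (.inl ())), .inr (.inr (.inl ())), v, rfl, rfl, ?_, bypass_id ?_ ?_⟩)))
  · refine ⟨⟨.inl (.inr (.inl ())), 0, Nat.zero_lt_one⟩, ⟨.inr (.inr (.inl ())), 0,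
      Nat.zero_lt_one⟩, rfl, rfl, (hl (.inr ⟨.inr (.inl ()), 0, Nat.zero_lt_one⟩)).trans ?_⟩
    refine (congrArg (contT _ _)
      (mergeDiagram_strand_mid l m v hv (.inr ⟨(), 0, Nat.zero_lt_one⟩))).trans ?_
    exact congrArg (inclT _ _) (splitDiagram_strand_mid l m v hv (.inl (0 : Fin 1)))
  · rintro ((p | p | p) | (p | p | p))
    exacts [p.elim, .inl rfl, p.elim, p.elim, .inr rfl, p.elim]
  · intro i
    refine Fin.addCases (fun i => ?_) (fun i => ?_) i
    · left
      refine (hl (.inl _)).trans ?_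
      refine (congrArg (contT _ _) (mergeDiagram_strand_left l m v hv i)).trans ?_
      exact congrArg (inclT _ _) (splitDiagram_strand_left l m v hv i)
    · refine Fin.addCases (fun i => ?_) (fun i => ?_) i
      -- The `i`-th strand entering the merge is attached to the `i`-th strand leaving the split.
      · right
        refine ⟨⟨.inl (.inr (.inl ())), i.1, i.2⟩, ⟨.inr (.inr (.inl ())), i.1, i.2⟩,
          rfl, rfl, rfl, (hl (.inl _)).trans ?_, ?_⟩
        · exact congrArg (contT _ _) (mergeDiagram_strand_mid l m v hv (.inl i))
        · refine (hr ⟨.inr (.inl ()), i.1, i.2⟩).trans ?_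
          exact congrArg (inclT _ _)
            (splitDiagram_strand_mid l m v hv (.inr ⟨(), i.1, i.2⟩))
      · left
        refine (hl (.inl _)).trans ?_
        refine (congrArg (contT _ _) (mergeDiagram_strand_right l m v hv i)).trans ?_
        exact congrArg (inclT _ _) (splitDiagram_strand_right l m v hv i)

/-- A reduction of type 0. The domain and range of the degenerate point are both `(k)` by
definition, so comparison with the identity makes sense. -/
theorem degenerate_juxtapose_id {k : V} (hk : Γ.Allowed (.degenerate k)) :
    ((pointDiagram (.degenerate k) hk).juxtapose (id m)).toHom =
      (id ((Tuple.single k).append m)).toHom := by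
  refine Step.toHom_eq (F := ((pointDiagram (.degenerate k) hk).juxtapose (id m)))
    (.inr (.inl ⟨.inl (), k, rfl, bypass_id ?_ ?_⟩))
  · rintro (p | p)
    exacts [.inl rfl, p.elim]
  · intro i
    refine Fin.addCases (fun i => ?_) (fun i => ?_) i
    · exact .inr ⟨⟨.inl (), i.1, i.2⟩, ⟨.inl (), i.1, i.2⟩, rfl, rfl, rfl,
        juxtapose_strand_leftO (pointDiagram (.degenerate k) hk) (id m) (.inl i),
        juxtapose_strand_leftO (pointDiagram (.degenerate k) hk) (id m) (.inr ⟨(), i.1, i.2⟩)⟩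
    · exact .inl (juxtapose_strand_rightO (pointDiagram (.degenerate k) hk) (id m) (.inl i))

end Elementary

/-- The empty tuple. -/
def emptyTuple (V : Type u) : Tuple V := ⟨0, Fin.elim0⟩

theorem col_emptyTuple_append (a : Tuple V) (i : Fin a.len) :
    ((emptyTuple V).append a).col ((finCongr (Nat.zero_add a.len)).symm i) = a.col i := by
  have e : (finCongr (Nat.zero_add a.len)).symm i = Fin.natAdd 0 i := by ext; simp
  rw [e]
  exact Fin.append_right (emptyTuple V).col a.col i

/-- Factoring off a point at the left end gives no left neighbors, while `splitDiagram` and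
`mergeDiagram` always carry a tuple `l`. This lemma supplies the empty `l`; the reordering accounts
for `0 + n` not being `n` by definition. -/
theorem reorder_iso_emptyTuple (F : StrandDiagram Γ a b) :
    Iso (F.reorder (a' := (emptyTuple V).append a) (b' := (emptyTuple V).append b)
      (finCongr (Nat.zero_add a.len)).symm (finCongr (Nat.zero_add b.len)).symm
      (col_emptyTuple_append a) (col_emptyTuple_append b))
      ((id (emptyTuple V)).juxtapose F) := by
  let f : ((id (emptyTuple V) : StrandDiagram Γ _ _).juxtapose F).Pt → F.Pt :=
    Sum.elim Empty.elim _root_.id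
  have h : ∀ p, F.type (f p) = ((id (emptyTuple V)).juxtapose F).type p := by
    rintro (p | p); exacts [p.elim, rfl]
  refine ⟨f, h, ⟨?_, fun p => ⟨.inr p, rfl⟩⟩, fun x => ?_⟩
  · rintro (p | p) (q | q) e
    · exact p.elim
    · exact p.elim
    · exact q.elim
    · exact congrArg _ e
  have hT : ∀ t, mapTerminus f h (rightT (id (emptyTuple V)) F t) =
      Sum.map (finCongr (Nat.zero_add b.len)).symm _root_.id t := by
    rintro (i | t)
    · refine congrArg Sum.inl (Fin.ext ?_)
      simp
      exact Nat.zero_add _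
    · rfl
  induction x using juxtapose_origin_cases with
  | left x =>
    rcases x with i | x
    exacts [i.elim0, x.pt.elim]
  | right x =>
    refine (congrArg _ (juxtapose_strand_rightO (id (emptyTuple V)) F x)).trans ((hT _).trans ?_)
    refine congrArg (fun z => Sum.map (finCongr (Nat.zero_add b.len)).symm _root_.id
      (F.strand z)) ?_
    rcases x with i | x
    · refine congrArg Sum.inl (Fin.ext ?_)
      exact (Nat.zero_add _).symm
    · rfl

/-! ### Decomposition of diagrams -/

theorem outColor_congr {t t' : PointType V} (h : t = t') {i : ℕ} (hi hi') :
    Γ.outColor t ⟨i, hi⟩ = Γ.outColor t' ⟨i, hi'⟩ := by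
  subst h; rfl

/-- If the first sources of `F` are joined to a point `p`, then `p` can be split off. -/
theorem exists_factor {t : PointType V} (ht : Γ.Allowed t)
    (F : StrandDiagram Γ ((inTuple Γ t).append m) b) (p : F.Pt) (hp : F.type p = t)
    (h : ∀ (i : ℕ) (hi : i < Γ.numIn t), F.strand (.inl (Fin.castAdd m.len ⟨i, hi⟩)) =
      .inr ⟨p, i, hp.symm ▸ hi⟩) :
    ∃ F' : StrandDiagram Γ ((outTuple Γ t).append m) b,
      Nat.card F'.Pt < Nat.card F.Pt ∧
        F.Iso (((pointDiagram t ht).juxtapose (id m)).comp F') := by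
  have := F.finite
  let type' : {q // q ≠ p} → PointType V := fun q => F.type q
  -- `F'` is `F` without `p`: its first sources stand for the strands leaving `p`, and its last ones
  -- are the sources of `F` that do not lead to `p`.
  let first : Fin (Γ.numOut t) → Origin Γ ((inTuple Γ t).append m) F.type :=
    fun i => .inr ⟨p, i.1, hp.symm ▸ i.2⟩
  let last : Fin m.len → Origin Γ ((inTuple Γ t).append m) F.type :=
    fun j => .inl (Fin.natAdd (Γ.numIn t) j)
  let lift : Origin Γ ((outTuple Γ t).append m) type' → Origin Γ ((inTuple Γ t).append m) F.type :=
    Sum.elim (Fin.append first last) fun x => .inr (x.map Subtype.val fun _ => rfl)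
  have lift_first : ∀ i, lift (.inl (Fin.castAdd m.len i)) = first i := Fin.append_left first last
  have lift_last : ∀ j, lift (.inl (Fin.natAdd (Γ.numOut t) j)) = last j :=
    Fin.append_right first last
  let emb : Terminus Γ b type' → Terminus Γ b F.type := mapTerminus Subtype.val fun _ => rfl
  have emb_inj : emb.Injective := by
    rintro (i | ⟨⟨q, hq⟩, i, hi⟩) (j | ⟨⟨r, hr⟩, j, hj⟩) e
    · exact congrArg _ (Sum.inl_injective e)
    · cases e
    · cases e
    · have e := Sum.inr_injective e
      simp only [Port.map, Port.mk.injEq] at e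
      obtain ⟨rfl, rfl⟩ := e
      rfl
  have cases' : ∀ {M : Origin Γ ((outTuple Γ t).append m) type' → Prop},
      (∀ i, M (.inl (Fin.castAdd m.len i))) → (∀ j, M (.inl (Fin.natAdd (Γ.numOut t) j))) →
      (∀ x, M (.inr x)) → ∀ x, M x := by
    intro M h1 h2 h3
    rintro (i | x)
    exacts [Fin.addCases h1 h2 i, h3 x]
  have lift_inj : lift.Injective := by
    refine cases' (fun i => ?_) (fun i => ?_) (fun x => ?_) <;>
      refine cases' (fun j => ?_) (fun j => ?_) (fun y => ?_) <;>
      intro e <;> (try simp only [lift_first, lift_last] at e)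
    · have e := congrArg Port.idx (Sum.inr_injective e)
      rw [Fin.ext e]
    · cases e
    · exact (y.pt.2 (congrArg Port.pt (Sum.inr_injective e)).symm).elim
    · cases e
    · rw [Fin.natAdd_injective _ _ (Sum.inl_injective e)]
    · cases e
    · exact (x.pt.2 (congrArg Port.pt (Sum.inr_injective e))).elim
    · cases e
    · have e := Sum.inr_injective e
      have ep : x.pt.1 = y.pt.1 := (Port.ext_iff.1 e).1
      have ei : x.idx = y.idx := (Port.ext_iff.1 e).2
      exact congrArg Sum.inr (Port.ext (Subtype.ext ep) ei)
  have lift_ne : ∀ x i (hi : i < Γ.numIn t), lift x ≠ .inl (Fin.castAdd m.len ⟨i, hi⟩) := by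
    intro x i hi
    revert x
    refine cases' (fun j => ?_) (fun j => ?_) (fun y => ?_)
    · rw [lift_first]
      exact Sum.inr_ne_inl
    · rw [lift_last]
      intro e
      have e := congrArg Fin.val (Sum.inl_injective e)
      simp at e
      omega
    · exact Sum.inr_ne_inl
  -- A strand in the image of `lift` cannot end at `p`, because all incoming ports of `p` are taken
  -- by the first sources, which `lift` misses.
  have ex : ∀ x, ∃ y, emb y = F.strand (lift x) := by
    intro x
    rcases hy : F.strand (lift x) with j | y
    · exact ⟨.inl j, rfl⟩
    · refine ⟨.inr ⟨⟨y.pt, fun hyp => ?_⟩, y.idx, y.lt⟩, rfl⟩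
      have hi : y.idx < Γ.numIn t := by
        have := y.lt
        rwa [hyp, hp] at this
      refine lift_ne x y.idx hi (F.strand.injective (hy.trans ((h _ hi).trans ?_).symm))
      exact congrArg Sum.inr (Port.ext hyp.symm rfl)
  choose s hs using ex
  have s_bij : s.Bijective := by
    refine ⟨fun x y e => lift_inj (F.strand.injective ?_), fun y => ?_⟩
    · rw [← hs, ← hs, e]
    · obtain ⟨x, hx⟩ := F.strand.surjective (emb y)
      -- The first sources are the only origins missed by `lift`, and their strands end at `p`,
      -- which is not a point of `F'`.
      have : ∃ x', lift x' = x := by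
        rcases x with i | z
        · induction i using Fin.addCases with
          | left i =>
            rw [show i = ⟨i.1, i.2⟩ from rfl, h] at hx
            rcases y with j | y
            · cases hx
            · exact (y.pt.2 (congrArg Port.pt (Sum.inr_injective hx)).symm).elim
          | right j => exact ⟨_, lift_last j⟩
        · by_cases hz : z.pt = p
          · have hi : z.idx < Γ.numOut t := by
              have := z.lt
              rwa [hz, hp] at this
            exact ⟨_, (lift_first ⟨z.idx, hi⟩).trans (congrArg Sum.inr (Port.ext hz.symm rfl))⟩
          · exact ⟨.inr ⟨⟨z.pt, hz⟩, z.idx, z.lt⟩, rfl⟩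
      obtain ⟨x', rfl⟩ := this
      exact ⟨x', emb_inj ((hs x').trans hx)⟩
  let F' : StrandDiagram Γ ((outTuple Γ t).append m) b :=
    { Pt := {q // q ≠ p}
      finite := inferInstance
      type := type'
      allowed := fun q => F.allowed q
      strand := Equiv.ofBijective s s_bij
      color := fun x => by
        have e : terminusColor Γ (s x) = terminusColor Γ (emb (s x)) := by
          rcases s x with _ | _ <;> rfl
        refine e.trans ?_
        rw [hs, F.color]
        clear e
        revert x
        refine cases' (fun i => ?_) (fun j => ?_) (fun _ => rfl)
        · rw [lift_first]
          exact (outColor_congr hp _ _).trans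
            (Fin.append_left (outTuple Γ t).col m.col i).symm
        · rw [lift_last]
          exact (Fin.append_right (inTuple Γ t).col m.col j).trans
            (Fin.append_right (outTuple Γ t).col m.col j).symm
      acyclic := fun q hq => by
        refine F.acyclic q (Relation.TransGen.lift Subtype.val ?_ _ _ hq)
        rintro _ _ ⟨x, y, rfl, rfl, hxy⟩
        refine ⟨x.map Subtype.val fun _ => rfl, y.map Subtype.val fun _ => rfl, rfl, rfl, ?_⟩
        have e := hs (.inr x)
        rw [show s (.inr x) = .inr y from hxy] at e
        exact e.symm }
  have hF' : ∀ x, emb (F'.strand x) = F.strand (lift x) := hs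
  refine ⟨F', Finite.card_subtype_lt (x := p) (by simp), ?_⟩
  let A := pointDiagram t ht
  let I : StrandDiagram Γ m m := id m
  let f : ((A.juxtapose I).comp F').Pt → F.Pt :=
    Sum.elim (fun _ => p) Subtype.val
  have hf : ∀ q, F.type (f q) = ((A.juxtapose I).comp F').type q := by
    rintro ((q | q) | q)
    exacts [hp, q.elim, rfl]
  have hT : ∀ y, mapTerminus f hf (inclT (A.juxtapose I) F' y) = emb y := by
    rintro (_ | _) <;> rfl
  refine ⟨f, hf, ⟨?_, ?_⟩, fun x => ?_⟩
  · rintro ((q | q) | q) ((r | r) | r) e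
    · rfl
    · exact r.elim
    · exact (r.2 e.symm).elim
    · exact q.elim
    · exact q.elim
    · exact q.elim
    · exact (q.2 e).elim
    · exact r.elim
    · exact congrArg Sum.inr (Subtype.ext e)
  · intro q
    by_cases hq : q = p
    · exact ⟨.inl (.inl ()), hq.symm⟩
    · exact ⟨.inr ⟨q, hq⟩, rfl⟩
  induction x using origin_cases with
  | left x =>
    refine (congrArg _ (compStrand_left (A.juxtapose I) F' x)).trans ?_
    induction x using juxtapose_origin_cases with
    | left x =>
      refine (congrArg (fun z => mapTerminus f hf (contT (A.juxtapose I) F' z))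
        (juxtapose_strand_leftO A I x)).trans ?_
      rcases x with i | x
      · exact (h i.1 i.2).symm
      · refine (hT _).trans ((hF' _).trans ?_)
        exact congrArg F.strand (lift_first ⟨x.idx, x.lt⟩)
    | right x =>
      refine (congrArg (fun z => mapTerminus f hf (contT (A.juxtapose I) F' z))
        (juxtapose_strand_rightO A I x)).trans ?_
      rcases x with i | x
      · refine (hT _).trans ((hF' _).trans ?_)
        exact congrArg F.strand (lift_last i)
      · exact x.pt.elim
  | right x =>
    refine (congrArg _ (compStrand_right (A.juxtapose I) F' x)).trans ?_
    exact (hT _).trans (hF' _)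

/-- The range of `g` is listed first, in the order given by `g`, and its complement afterwards in
any order. This brings the sources that lead to a chosen point to the front, in the order of its
ports. -/
theorem exists_equiv_castAdd {n k : ℕ} (g : Fin n → Fin k) (hg : g.Injective) :
    ∃ (r : ℕ) (σ : Fin k ≃ Fin (n + r)), ∀ i, σ (g i) = Fin.castAdd r i := by
  classical
  obtain ⟨r, ⟨e⟩⟩ := Finite.exists_equiv_fin ↥(Set.range g)ᶜ
  refine ⟨r, (Equiv.Set.sumCompl (Set.range g)).symm.trans
    ((Equiv.sumCongr (Equiv.ofInjective g hg).symm e).trans finSumFinEquiv), fun i => ?_⟩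
  rw [Equiv.trans_apply, Equiv.Set.sumCompl_symm_apply_of_mem (Set.mem_range_self i)]
  simp

/-- By acyclicity, reachability is a strict order on a finite set, so it has a minimal element. -/
theorem exists_first_point (F : StrandDiagram Γ a b) [Nonempty F.Pt] :
    ∃ p, ∀ q, ¬ Joined Γ F.strand q p := by
  have := F.finite
  have : IsStrictOrder F.Pt (Relation.TransGen (Joined Γ F.strand)) :=
    { irrefl := F.acyclic, trans := fun _ _ _ => Relation.TransGen.trans }
  obtain ⟨p, -, hp⟩ := (Finite.wellFounded_of_trans_of_irrefl
    (Relation.TransGen (Joined Γ F.strand))).has_min Set.univ Set.univ_nonempty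
  exact ⟨p, fun q hq => hp q trivial (.single hq)⟩

/-- Every diagram with a point is, up to a permutation of its sources, the composition of a diagram
with a single point and a diagram with fewer points. -/
theorem exists_reorder_factor (F : StrandDiagram Γ a b) [Nonempty F.Pt] :
    ∃ (t : PointType V) (ht : Γ.Allowed t) (m : Tuple V)
      (σ : Fin a.len ≃ Fin ((inTuple Γ t).append m).len)
      (hσ : ∀ i, ((inTuple Γ t).append m).col (σ i) = a.col i)
      (F' : StrandDiagram Γ ((outTuple Γ t).append m) b), Nat.card F'.Pt < Nat.card F.Pt ∧
      (F.reorder σ (Equiv.refl _) hσ fun _ => rfl).Iso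
        (((pointDiagram t ht).juxtapose (id m)).comp F') := by
  obtain ⟨p, hp⟩ := F.exists_first_point
  -- No point precedes `p`, so each strand entering `p` originates from a source, called `g i`
  -- below.
  have ex : ∀ i : Fin (Γ.numIn (F.type p)), ∃ j, F.strand (.inl j) = .inr ⟨p, i.1, i.2⟩ := by
    intro i
    obtain ⟨j | x, hx⟩ := F.strand.surjective (.inr ⟨p, i.1, i.2⟩)
    · exact ⟨j, hx⟩
    · exact (hp _ ⟨x, _, rfl, rfl, hx⟩).elim
  choose g hg using ex
  have g_inj : g.Injective := fun i j e => by
    have e := hg i ▸ hg j ▸ congrArg (fun z => F.strand (.inl z)) e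
    exact Fin.ext (congrArg Port.idx (Sum.inr_injective e))
  obtain ⟨r, σ, hσ⟩ := exists_equiv_castAdd g g_inj
  have hσ' : ∀ i, σ.symm (Fin.castAdd r i) = g i := fun i => by rw [← hσ, σ.symm_apply_apply]
  let m : Tuple V := ⟨r, fun j => a.col (σ.symm (Fin.natAdd _ j))⟩
  have col : ∀ i, ((inTuple Γ (F.type p)).append m).col (σ i) = a.col i := by
    intro i
    obtain ⟨i, rfl⟩ := σ.symm.surjective i
    rw [σ.apply_symm_apply]
    induction i using Fin.addCases with
    | left i =>
      rw [hσ']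
      have := F.color (.inl (g i))
      rw [hg] at this
      exact (Fin.append_left (inTuple Γ (F.type p)).col m.col i).trans this
    | right i => exact Fin.append_right (inTuple Γ (F.type p)).col m.col i
  refine ⟨F.type p, F.allowed p, m, σ, col, ?_⟩
  refine exists_factor (F.allowed p) (F.reorder (a' := (inTuple Γ (F.type p)).append m) σ
    (Equiv.refl _) col fun _ => rfl) p rfl fun i hi => ?_
  change Sum.map _root_.id _root_.id (F.strand (.inl (σ.symm (Fin.castAdd r ⟨i, hi⟩)))) = _
  rw [hσ', hg]
  rfl

/-- To prove a property of the classes of all diagrams that is preserved by composition, it suffices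
to prove it for permutations, split diagrams and merge diagrams. -/
theorem induction_elementary {M : ∀ {a b : Tuple V}, StrandDiagram Γ a b → Prop}
    (congr : ∀ {a b : Tuple V} {F G : StrandDiagram Γ a b}, F.toHom = G.toHom → M F → M G)
    (comp : ∀ {a b c : Tuple V} {F : StrandDiagram Γ a b} {G : StrandDiagram Γ b c},
      M F → M G → M (F.comp G))
    (perm : ∀ {a b : Tuple V} (σ : Fin a.len ≃ Fin b.len) (h : ∀ i, b.col (σ i) = a.col i),
      M (ofEquiv σ h))
    (split : ∀ (l m : Tuple V) (v : V) (hv : 2 ≤ Γ.outDegree v), M (splitDiagram l v hv m))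
    (merge : ∀ (l m : Tuple V) (v : V) (hv : 2 ≤ Γ.outDegree v), M (mergeDiagram l v hv m))
    (F : StrandDiagram Γ a b) : M F := by
  -- A reordering is undone by composing with permutations, for which `M` is known.
  have of_reorder : ∀ {a b a' b' : Tuple V} (F : StrandDiagram Γ a b) (σ : Fin a.len ≃ Fin a'.len)
      (τ : Fin b.len ≃ Fin b'.len) (hσ : ∀ i, a'.col (σ i) = a.col i)
      (hτ : ∀ i, b'.col (τ i) = b.col i), M (F.reorder σ τ hσ hτ) → M F := by
    intro a b a' b' F σ τ hσ hτ H
    refine congr ?_ (comp (perm σ hσ) (comp H (perm τ.symm (col_symm hτ))))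
    rw [toHom_comp, toHom_comp, toHom_reorder]
    change (permIso σ hσ).hom ≫ ((permIso σ hσ).inv ≫ F.toHom ≫ (permIso τ hτ).hom) ≫
      (permIso τ hτ).inv = _
    simp
  have point : ∀ (t : PointType V) (ht : Γ.Allowed t) (m : Tuple V),
      M ((pointDiagram t ht).juxtapose (id m)) := by
    intro t ht m
    cases t with
    | split v =>
      refine congr ((pointDiagram_split_iso v ht).juxtapose (Iso.refl (id m))).toHom_eq.symm ?_
      exact of_reorder _ _ _ _ _ (congr (reorder_iso_emptyTuple _).toHom_eq.symm
        (split (emptyTuple V) m v ht))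
    | merge v =>
      refine congr ((pointDiagram_merge_iso v ht).juxtapose (Iso.refl (id m))).toHom_eq.symm ?_
      exact of_reorder _ _ _ _ _ (congr (reorder_iso_emptyTuple _).toHom_eq.symm
        (merge (emptyTuple V) m v ht))
    | degenerate v => exact congr (degenerate_juxtapose_id m ht).symm (perm _ _)
  -- The domain is generalized because cutting off the top point changes it; the range stays fixed.
  induction hn : Nat.card F.Pt using Nat.strong_induction_on generalizing a with
  | _ n ih =>
    rcases isEmpty_or_nonempty F.Pt with hF | hF
    · obtain ⟨σ, h, e⟩ := F.iso_ofEquiv_of_isEmpty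
      exact congr e.toHom_eq.symm (perm σ h)
    · obtain ⟨t, ht, m, σ, hσ, F', hlt, e⟩ := F.exists_reorder_factor
      exact of_reorder F _ _ _ _
        (congr e.toHom_eq.symm (comp (point t ht m) (ih _ (hn ▸ hlt) F' rfl)))

/-- Invertibility passes to products, so the elementary diagrams suffice; there splits and merges of
the same color are inverse to each other. Thus the category is a groupoid. -/
theorem isIso_toHom (F : StrandDiagram Γ a b) : IsIso F.toHom := by
  refine induction_elementary (M := fun F => IsIso F.toHom) ?_ ?_ ?_ ?_ ?_ F
  · intro a b F G h H
    exact h ▸ H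
  · intro a b c F G hF hG
    rw [toHom_comp]
    infer_instance
  · exact fun σ h => (permIso σ h).isIso_hom
  · exact fun l m v hv => ⟨(mergeDiagram l v hv m).toHom, split_comp_merge l m v hv,
      merge_comp_split l m v hv⟩
  · exact fun l m v hv => ⟨(splitDiagram l v hv m).toHom, merge_comp_split l m v hv,
      split_comp_merge l m v hv⟩

/-! ### From equivalence to conjugacy -/

/-- The classes of `F` and `G` are conjugate. -/
def Conj (F : StrandDiagram Γ a a) (G : StrandDiagram Γ b b) : Prop :=
  StrandGroupoid.Conjugate (a := obj Γ a) (b := obj Γ b) F.toHom G.toHom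

/-- `[K]` is automatically invertible, so `[FK] = [KG]` can be solved for `[F]`. -/
theorem conj_of_intertwine {F : StrandDiagram Γ a a} {G : StrandDiagram Γ b b}
    (K : StrandDiagram Γ a b) (h : (F.comp K).toHom = (K.comp G).toHom) : F.Conj G := by
  have := K.isIso_toHom
  refine ⟨asIso K.toHom, ?_⟩
  rw [toHom_comp, toHom_comp] at h
  rw [asIso_hom, ← reassoc_of% h]
  simp

theorem Conj.refl (F : StrandDiagram Γ a a) : F.Conj F := 
  ⟨CategoryTheory.Iso.refl _, by simp⟩

theorem Conj.symm {F : StrandDiagram Γ a a} {G : StrandDiagram Γ b b} (h : F.Conj G) :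
    G.Conj F := by
  obtain ⟨h, e⟩ := h
  exact ⟨h.symm, by simp [e]⟩

theorem Conj.trans {F : StrandDiagram Γ a a} {G : StrandDiagram Γ b b} {H : StrandDiagram Γ c c}
    (h : F.Conj G) (h' : G.Conj H) : F.Conj H := by
  obtain ⟨h, e⟩ := h
  obtain ⟨h', e'⟩ := h'
  exact ⟨h ≪≫ h', by simp [e, e']⟩

theorem conj_of_toHom_eq {F G : StrandDiagram Γ a a} (h : F.toHom = G.toHom) : F.Conj G :=
  ⟨CategoryTheory.Iso.refl _, by simp [h]⟩

/-- `F` itself intertwines, as `(FG)F = F(GF)`. All four base line shifts are instances. -/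
theorem conj_comp_comm (F : StrandDiagram Γ a b) (G : StrandDiagram Γ b a) :
    (F.comp G).Conj (G.comp F) :=
  conj_of_intertwine F (by simp only [toHom_comp, Category.assoc])

theorem conj_reorder (F : StrandDiagram Γ a a) (σ : Fin a.len ≃ Fin b.len)
    (hσ : ∀ i, b.col (σ i) = a.col i) : F.Conj (F.reorder σ σ hσ hσ) :=
  ⟨permIso σ hσ, by simp [toHom_reorder]⟩

/-- The diagram from which a closed diagram arises. -/
def _root_.EdgeShift.ClosedStrandDiagram.cut (C : ClosedStrandDiagram Γ) :
    StrandDiagram Γ C.base C.base where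
  Pt := C.Pt
  finite := C.finite
  type := C.type
  allowed := C.allowed
  strand := C.strand
  color := C.color
  acyclic := C.acyclic

theorem children_eq_single {v : V} (h : Γ.outDegree v = 1)
    (h' : ∀ e, Γ.init e = v → Γ.term e = v) : Γ.children v = Tuple.single v := by
  -- The length is made a variable so that it can be replaced by 1 in the type of the coloring.
  have key : ∀ (n : ℕ) (f : Fin n → V), n = 1 → (∀ i, f i = v) →
      (⟨n, f⟩ : Tuple V) = Tuple.single v := by
    rintro _ f rfl hf
    rw [funext hf]
    rfl
  exact key _ _ h fun i => h' _ (Γ.edge v i).2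

/-- Invariance under type 3. In out-degree 1 the only edge is a loop, so both sides are the same
diagram; in higher out-degree `k` parallel merges of color `v` intertwine them. In out-degree 0 a
loop would be created from nothing, which `hv` excludes. -/
theorem conj_insert_loops (l m : Tuple V) (v : V) (k : ℕ) (hv : Γ.outDegree v ≠ 0)
    (h1 : Γ.outDegree v = 1 → ∀ e, Γ.init e = v → Γ.term e = v)
    (R : StrandDiagram Γ (l.append m) (l.append m)) :
    (insert l m (loops k (Γ.children v)) R).Conj (insert l m (loops k (Tuple.single v)) R) := by
  by_cases h : Γ.outDegree v = 1
  · rw [children_eq_single h (h1 h)]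
    exact Conj.refl _
  · have hv : 2 ≤ Γ.outDegree v := by omega
    obtain ⟨K, hK⟩ := exists_intertwine_insert l m _
      (loops_comp_copies_iso k (invertedCaret v hv)) R
    exact conj_of_intertwine K hK

theorem conj_of_move (h0 : ∀ v : V, Γ.outDegree v ≠ 0)
    (h1 : ∀ v, Γ.outDegree v = 1 → ∀ e, Γ.init e = v → Γ.term e = v)
    {C C' : ClosedStrandDiagram Γ} (h : C.Move C') : C.cut.Conj C'.cut := by
  rcases h with h | h | h | h
  · cases h <;> exact conj_comp_comm _ _
  · obtain ⟨F, σ, hσ⟩ := h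
    exact conj_reorder F σ hσ
  · obtain ⟨h⟩ := h
    exact conj_of_toHom_eq (Step.toHom_eq h)
  · obtain ⟨l, m, v, k, hk, R⟩ := h
    exact conj_insert_loops l m v k (h0 v) (h1 v) R

theorem conj_of_equivalent (h0 : ∀ v : V, Γ.outDegree v ≠ 0)
    (h1 : ∀ v, Γ.outDegree v = 1 → ∀ e, Γ.init e = v → Γ.term e = v)
    {C C' : ClosedStrandDiagram Γ} (h : C.Equivalent C') : C.cut.Conj C'.cut := by
  induction h with
  | rel _ _ h => exact conj_of_move h0 h1 h
  | refl => exact Conj.refl _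
  | symm _ _ _ ih => exact ih.symm
  | trans _ _ _ _ _ ih ih' => exact ih.trans ih'

/-! ### From conjugacy to equivalence -/

/-- Equal classes are linked by a chain of steps and inverse steps, each of which closes to a
`Reduction012` or its inverse. -/
theorem equivalent_of_toHom_eq {F G : StrandDiagram Γ a a} (h : F.toHom = G.toHom) :
    F.close.Equivalent G.close := by
  replace h : Relation.EqvGen Step F G := Quot.eqvGen_exact h
  induction h with
  | rel _ _ h => exact .rel _ _ (.inr (.inr (.inl ⟨h⟩)))
  | refl => exact .refl _
  | symm _ _ _ ih => exact .symm _ _ ih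
  | trans _ _ _ _ _ ih ih' => exact .trans _ _ _ ih ih'

/-- The trace property. It holds for products because `(FG)X = F(GX)` becomes `(GX)F = G(XF)` and
then `(XF)G`. This uses the property of each factor with a different `X`, so `X` is quantified
inside the induction. For splits and merges it is a shift. -/
theorem equivalent_comp_comm (F : StrandDiagram Γ a b) (X : StrandDiagram Γ b a) :
    (F.comp X).close.Equivalent (X.comp F).close := by
  refine induction_elementary (M := fun {a b} F => ∀ X : StrandDiagram Γ b a,
    (F.comp X).close.Equivalent (X.comp F).close) ?_ ?_ ?_ ?_ ?_ F X
  · intro a b F G h H X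
    have e1 : (G.comp X).toHom = (F.comp X).toHom := by rw [toHom_comp, toHom_comp, h]
    have e2 : (X.comp F).toHom = (X.comp G).toHom := by rw [toHom_comp, toHom_comp, h]
    exact (equivalent_of_toHom_eq e1).trans _ _ _
      ((H X).trans _ _ _ (equivalent_of_toHom_eq e2))
  · intro a b c F G hF hG X
    have e1 : ((F.comp G).comp X).toHom = (F.comp (G.comp X)).toHom := by
      simp only [toHom_comp, Category.assoc]
    have e2 : ((G.comp X).comp F).toHom = (G.comp (X.comp F)).toHom := by
      simp only [toHom_comp, Category.assoc]
    have e3 : ((X.comp F).comp G).toHom = (X.comp (F.comp G)).toHom := by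
      simp only [toHom_comp, Category.assoc]
    exact (equivalent_of_toHom_eq e1).trans _ _ _ <| (hF _).trans _ _ _ <|
      (equivalent_of_toHom_eq e2).trans _ _ _ <| (hG _).trans _ _ _ (equivalent_of_toHom_eq e3)
  · intro a b σ h X
    -- Permuting the base points by `σ` conjugates the product, which moves the permutation from the
    -- top to the bottom.
    have e : (((ofEquiv σ h).comp X).reorder σ σ h h).toHom = (X.comp (ofEquiv σ h)).toHom := by
      rw [toHom_reorder, toHom_comp, toHom_comp]
      change (permIso σ h).inv ≫ ((permIso σ h).hom ≫ X.toHom) ≫ (permIso σ h).hom =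
        X.toHom ≫ (permIso σ h).hom
      simp
    exact .trans _ _ _ (.rel _ _ (.inr (.inl ⟨_, σ, h⟩))) (equivalent_of_toHom_eq e)
  · exact fun l m v hv X => .rel _ _ (.inl (.expandSplit l m v hv X))
  · exact fun l m v hv X => .rel _ _ (.inl (.reduceMerge l m v hv X))

/-- With `H` and `K` representing the conjugator and its inverse, `F` has the class of `HGK`; moving
`H` around the closed diagram gives `GKH`, which has the class of `G`. -/
theorem Conj.equivalent {F : StrandDiagram Γ a a} {G : StrandDiagram Γ b b} (h : F.Conj G) :
    F.close.Equivalent G.close := by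
  obtain ⟨h, e⟩ := h
  obtain ⟨H, hH⟩ : ∃ H : StrandDiagram Γ a b, H.toHom = h.hom := Quot.exists_rep h.hom
  obtain ⟨K, hK⟩ : ∃ K : StrandDiagram Γ b a, K.toHom = h.inv := Quot.exists_rep h.inv
  have e1 : F.toHom = (H.comp (G.comp K)).toHom := by rw [toHom_comp, toHom_comp, hH, hK, e]
  have e2 : ((G.comp K).comp H).toHom = G.toHom := by rw [toHom_comp, toHom_comp, hH, hK]; simp
  exact (equivalent_of_toHom_eq e1).trans _ _ _ <|
    (equivalent_comp_comm _ _).trans _ _ _ (equivalent_of_toHom_eq e2)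

end StrandDiagram

end EdgeShift

theorem mainTheorem2 {V E : Type*} [Finite V] [Finite E] (Γ : EdgeShift.OrderedGraph V E)
    (no_dead_ends : ∀ v : V, ∃ e : E, Γ.init e = v)
    (no_redundant_edges : ∀ v : V, Γ.outDegree v = 1 → ∀ e : E, Γ.init e = v → Γ.term e = v)
    {a b : EdgeShift.Tuple V}
    (F : EdgeShift.StrandDiagram Γ a a) (G : EdgeShift.StrandDiagram Γ b b) :
    EdgeShift.StrandGroupoid.Conjugate F.toClass G.toClass ↔
      F.close.Equivalent G.close := by
  have h0 : ∀ v, Γ.outDegree v ≠ 0 := fun v hv => by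
    obtain ⟨e, he⟩ := no_dead_ends v
    exact (finCongr hv ((Γ.edge v).symm ⟨e, he⟩)).elim0
  -- `toClass` and `toHom` agree by definition, and so do `F.close.cut` and `F`.
  exact ⟨fun h => EdgeShift.StrandDiagram.Conj.equivalent (F := F) (G := G) h,
    EdgeShift.StrandDiagram.conj_of_equivalent h0 no_redundant_edges⟩
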